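/- Let $\mathcal X$ be a finite alphabet with $|\mathcal X|\ge 2$. The Ising channel over $\mathcal X$ has, at each time $t$, input $X_t$, state $S_{t-1}$ and output $Y_t$, where $Y_t=X_t$ or $Y_t=S_{t-1}$, each with probability $1/2$ (independently over time), and $S_t=X_t$; the initial state $S_0$ is arbitrary. With feedback, $X_t$ is a function of the message and of $Y_1,\dots,Y_{t-1}$. Logarithms are to base 2 and $H_2(p)=-p\log p-(1-p)\log(1-p)$. Consider the following scheme for sending a stream $\nu_1,\dots,\nu_K\in\mathcal X$ ($K\ge1$). Encoder: send $\nu_1$ twice. For $i\ge 2$, if $\nu_i=\nu_{i-1}$ send $\nu_i$ twice; if $\nu_i\ne\nu_{i-1}$ send $\nu_i$ once, and send it a second time if and only if the output just received differs from $\nu_i$. Decoder: $\hat\nu_1$ is the second output; for $i\ge2$, if the next output differs from $\hat\nu_{i-1}$ it is $\hat\nu_i$, and otherwise $\hat\nu_i$ is the output following it. The transmission stops when $K$ symbols have been decoded. 1. (Zero error.) For every stream, every initial state and every behaviour of the channel, the scheme stops after at most $2K$ channel uses and $\hat\nu_i=\nu_i$ for all $i\le K$. 2. (Markov streams.) Let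 $p\in[0,1]$, let $\nu_1$ be uniform, and let $\nu_i=\nu_{i-1}$ with probability $p$ and $\nu_i$ be uniform on $\mathcal X\setminus\{\nu_{i-1}\}$ with probability $1-p$. Then $H(\nu_1,\dots,\nu_K)=\log|\mathcal X|+(K-1)\,h(p)$ with $h(p)=H_2(p)+(1-p)\log(|\mathcal X|-1)$, and the expected number of channel uses is $2+(K-1)\,\ell(p)$ with $\ell(p)=2p+1.5(1-p)$, for every initial state. 3. (Rate.) Let $p\in(0,1)$. Then $h(p)/\ell(p)=R_p:=\dfrac{2\left(H_2(p)+(1-p)\log(|\mathcal X|-1)\right)}{p+3}$, and there are lengths $K_n\ge1$ and injective maps $\varphi_n:\{0,1\}^n\to\mathcal X^{K_n}$ such that, for a message of $n$ uniform bits, (a) the law of the stream $\varphi_n(\text{message})$ has relative entropy $o(K_n)$ with respect to the Markov law of part 2; (b) applying the scheme to this stream gives a zero-error feedback code that stops after at most $2K_n$ channel uses; (c) as $n\to\infty$, for every initial state, the expected number $T_n$ of channel uses satisfies $n/K_n\to h(p)$, $T_n/K_n\to\ell(p)$ and $n/T_n\to R_p$. 4. (Maximum.) The maximum $R(\mathcal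 X)=\max_{p\in[0,1]}R_p$ exists and is attained at some $p\in(0,1)$, so that the scheme with this $p$ achieves the rate $R(\mathcal X)$. Moreover $R(\mathcal X)$ is an achievable rate for block codes with feedback: for every $\varepsilon>0$ and every sufficiently large $T$ there is a feedback code of block length $T$ with at least $2^{T(R(\mathcal X)-\varepsilon)}$ messages and error probability at most $\varepsilon$ for every message and every initial state. For $|\mathcal X|=3$, $R(\mathcal X)=\max_{p\in[0,1]}2\,\dfrac{H_2(p)+1-p}{p+3}$. -/

import Mathlib

open MeasureTheory

namespace Ising

/-! ### The Ising channel with noiseless feedback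

The state at time `t` is the previous input, and the output equals the input or the state, each
with probability `1/2`, according to a fresh fair coin.  Times are numbered from `0`; output
histories are lists in chronological order. -/

/-- The law of an i.i.d. sequence of fair coins. -/
noncomputable def coinLaw : Measure (ℕ → Bool) :=
  Measure.infinitePi fun _ => (PMF.uniformOfFintype Bool).toMeasure

/-- The channel output for input `x` and state `s`, when the coin shows `b`. -/
def channelOut {X : Type*} (b : Bool) (x s : X) : X := if b then x else s

/-- The outputs and the current channel state after `t` channel uses, for a feedback encoder `enc`
(past outputs ↦ next input), initial state `s₀` and coin sequence `ω`. -/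
def run {X : Type*} (enc : List X → X) (s₀ : X) (ω : ℕ → Bool) : ℕ → List X × X
  | 0 => ([], s₀)
  | t + 1 =>
    let ys := (run enc s₀ ω t).1
    let s := (run enc s₀ ω t).2
    (ys ++ [channelOut (ω t) (enc ys) s], enc ys)

/-- The outputs during the first `t` channel uses. -/
def outputs {X : Type*} (enc : List X → X) (s₀ : X) (ω : ℕ → Bool) (t : ℕ) : List X :=
  (run enc s₀ ω t).1

/-! ### Feedback codes -/

/-- A variable-length feedback code with message set `M`.  The next input depends on the message
and the past outputs.  From the outputs received so far the decoder either announces a message,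
which ends the transmission, or asks for a further channel use (`none`). -/
structure VarCode (M X : Type*) where
  encode : M → List X → X
  decide : List X → Option M

/-- The transmission of `m` ends after exactly `t` channel uses, with announced message `m'`. -/
def VarCode.StopsWith {M X : Type*} (C : VarCode M X) (s₀ : X) (m : M) (ω : ℕ → Bool)
    (t : ℕ) (m' : M) : Prop :=
  C.decide (outputs (C.encode m) s₀ ω t) = some m' ∧
    ∀ k < t, C.decide (outputs (C.encode m) s₀ ω k) = none

/-- The number of channel uses (infinite if the decoder never announces a message). -/
noncomputable def VarCode.time {M X : Type*} (C : VarCode M X) (s₀ : X) (m : M)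
    (ω : ℕ → Bool) : ℕ∞ :=
  sInf {k : ℕ∞ | ∃ t : ℕ, k = t ∧ C.decide (outputs (C.encode m) s₀ ω t) ≠ none}

/-- The expected number of channel uses for the message `m`. -/
noncomputable def VarCode.expectedTime {M X : Type*} (C : VarCode M X) (s₀ : X) (m : M) : ℝ :=
  (∫⁻ ω, (C.time s₀ m ω : ENNReal) ∂coinLaw).toReal

/-- Zero error, within at most `T` channel uses: for every initial state, message and behaviour of
the channel, the transmission ends after at most `T` uses and the message is decoded correctly. -/
def VarCode.ZeroErrorWithin {M X : Type*} (C : VarCode M X) (T : ℕ) : Prop :=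
  ∀ (s₀ : X) (m : M) (ω : ℕ → Bool), ∃ t ≤ T, C.StopsWith s₀ m ω t m

/-- `R` (in bits per channel use) is an achievable rate of the Ising channel with feedback, for
codes of fixed block length: for every `ε > 0` and all large block lengths `T` there is a feedback
code with at least `2 ^ (T (R - ε))` messages whose error probability is at most `ε`, for every
message and every initial state (which neither encoder nor decoder knows). -/
def IsAchievable (X : Type*) (R : ℝ) : Prop :=
  ∀ ε > 0, ∀ᶠ T : ℕ in Filter.atTop,
    ∃ (M : ℕ) (enc : Fin M → List X → X) (dec : List X → Fin M),
      (2 : ℝ) ^ ((T : ℝ) * (R - ε)) ≤ (M : ℝ) ∧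
      ∀ (s₀ : X) (m : Fin M),
        (coinLaw {ω | dec (outputs (enc m) s₀ ω T) ≠ m}).toReal ≤ ε

/-! ### The coding scheme -/

section Scheme

variable {X : Type*} [DecidableEq X]

/-- The encoder after the first symbol: `u` is the symbol completed last, the second argument lists
the symbols still to be sent, the third the outputs received since `u` was completed.
A symbol `v ≠ u` is sent once if the output equals `v`, and twice otherwise; a symbol `v = u` is
sent twice.  (After the last symbol the transmission is over and the value is irrelevant.) -/
def encodeRest : X → List X → List X → X
  | u, [], _ => u
  | _, v :: _, [] => v
  | u, v :: vs, y :: ys =>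
    if v ≠ u ∧ y = v then encodeRest v vs ys
    else
      match ys with
      | [] => v
      | _ :: ys' => encodeRest v vs ys'

/-- The encoder for the symbol stream `ν`: the first symbol is always sent twice. -/
def schemeEncode {N : ℕ} (ν : Fin (N + 1) → X) : List X → X
  | [] => ν 0
  | [_] => ν 0
  | _ :: _ :: ys => encodeRest (ν 0) (List.ofFn (Fin.tail ν)) ys

/-- The decoder after the first symbol: `u` is the symbol decoded last.  An output `y ≠ u` is the
next symbol; after an output `y = u` the following output is the next symbol. -/
def decodeRest : X → List X → List X
  | _, [] => []
  | u, [y] => if y ≠ u then [y] else []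
  | u, y :: y' :: ys => if y ≠ u then y :: decodeRest y (y' :: ys) else y' :: decodeRest y' ys

/-- The symbols decoded from the outputs received so far. -/
def schemeDecode : List X → List X
  | _ :: y :: ys => y :: decodeRest y ys
  | _ => []

open Classical in
/-- The scheme used with a map `φ` from messages to symbol streams of length `N + 1`: the
transmission ends as soon as the decoded symbols form the stream of a message. -/
noncomputable def schemeCode {M : Type*} {N : ℕ} (φ : M → Fin (N + 1) → X) : VarCode M X where
  encode m := schemeEncode (φ m)
  decide ys :=
    if h : ∃ m, List.ofFn (φ m) = schemeDecode ys then some h.choose else none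

variable [Fintype X]

/-- Transition probabilities of the symbol stream: repeat the last symbol with probability `p`,
otherwise pick one of the other symbols uniformly. -/
noncomputable def transition (p : ℝ) (u v : X) : ℝ :=
  if v = u then p else (1 - p) / ((Fintype.card X : ℝ) - 1)

/-- The law of the first `N + 1` symbols of the stationary Markov stream. -/
noncomputable def markovLaw (p : ℝ) (N : ℕ) (ν : Fin (N + 1) → X) : ℝ :=
  (1 / (Fintype.card X : ℝ)) * ∏ i : Fin N, transition p (ν i.castSucc) (ν i.succ)

/-- The law of the symbol stream `φ m` of a uniformly distributed message `m`. -/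
noncomputable def streamLaw {M : Type*} [Fintype M] {N : ℕ} (φ : M → Fin (N + 1) → X)
    (ν : Fin (N + 1) → X) : ℝ :=
  (Fintype.card {m // φ m = ν} : ℝ) / (Fintype.card M : ℝ)

end Scheme

/-! ### Entropies (in bits) and rates -/

/-- Shannon entropy of a probability mass function. -/
noncomputable def entropy {A : Type*} [Fintype A] (P : A → ℝ) : ℝ :=
  -∑ a, P a * Real.logb 2 (P a)

/-- Relative entropy `D(P ‖ Q)` (for `Q` without zeros). -/
noncomputable def relEntropy {A : Type*} [Fintype A] (P Q : A → ℝ) : ℝ :=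
  ∑ a, P a * Real.logb 2 (P a / Q a)

/-- Binary entropy. -/
noncomputable def H₂ (p : ℝ) : ℝ := -p * Real.logb 2 p - (1 - p) * Real.logb 2 (1 - p)

/-- The entropy rate of the symbol stream. -/
noncomputable def symbolEntropy (X : Type*) [Fintype X] (p : ℝ) : ℝ :=
  H₂ p + (1 - p) * Real.logb 2 ((Fintype.card X : ℝ) - 1)

/-- The expected number of channel uses per symbol. -/
noncomputable def symbolTime (p : ℝ) : ℝ := 2 * p + 1.5 * (1 - p)

/-- The rate of the scheme with parameter `p`. -/
noncomputable def schemeRate (X : Type*) [Fintype X] (p : ℝ) : ℝ :=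
  2 * (H₂ p + (1 - p) * Real.logb 2 ((Fintype.card X : ℝ) - 1)) / (p + 3)

end Ising

/-! Once a symbol `u` is completed, the channel state is `u` and the decoder knows `u`. A new symbol
`v ≠ u` comes out as `v` or, with probability 1/2, as `u`; in the second case the state has become
`v`, so the repetition is received with certainty. A repeated symbol always produces `u, u`. Hence
an output other than `u` is the next symbol, and an output `u` says that the following output is.
Decoding is exact (`decodeRest_restTime`) and never complete too early (`length_decodeRest_lt`).

For `N + 1` symbols with `d` changes, the time is `2 + 2N` minus a binomial variable with parameters
`d`, 1/2, whatever the initial state: its mean is `meanTime N d` and its variance `d / 4`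
(`restExp_add_const`, `restExp_sub_sq`). The Markov probability of a stream also depends only on
`d`, and `d` is binomial with parameters `N`, `1 - p`.

So fix `d` at its mode. This class of streams has probability at least `1 / (N + 1)`
(`one_le_mul_binomial_mode`) and equally likely members, so the binary logarithm of its size is `N
h(p) + o(N)`, while all members have the same mean time, about `N ℓ(p)`. Mapping `n` bits
injectively into the first class large enough gives rate `h / ℓ`, with relative entropy exactly
`markovCost - n = o(N)`. Stopping at a block length slightly above the mean time gives block codes,
by Chebyshev. The maximum exists by compactness; comparison with interior points excludes both
endpoints. -/

namespace Ising

/-! ### Causality of the channel and stopping times. -/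

section Channel

variable {X : Type*}

/-- Running an encoder for `t + 1` steps is one step followed by a run of the encoder that
remembers the first output. -/
theorem outputs_succ_eq_cons (enc : List X → X) (s₀ : X) (ω : ℕ → Bool) (t : ℕ) :
    outputs enc s₀ ω (t + 1) = channelOut (ω 0) (enc []) s₀ ::
      outputs (fun ys => enc (channelOut (ω 0) (enc []) s₀ :: ys)) (enc [])
        (fun i => ω (i + 1)) t := by
  suffices h : run enc s₀ ω (t + 1) =
      (channelOut (ω 0) (enc []) s₀ ::
        (run (fun ys => enc (channelOut (ω 0) (enc []) s₀ :: ys)) (enc [])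
          (fun i => ω (i + 1)) t).1,
       (run (fun ys => enc (channelOut (ω 0) (enc []) s₀ :: ys)) (enc [])
          (fun i => ω (i + 1)) t).2) by
    simp only [outputs, h]
  induction t with
  | zero => simp [run]
  | succ t ih =>
    rw [run, ih]
    simp [run]

theorem outputs_length (enc : List X → X) (s₀ : X) (ω : ℕ → Bool) (t : ℕ) :
    (outputs enc s₀ ω t).length = t := by
  induction t with
  | zero => simp [outputs, run]
  | succ t ih => simpa [outputs, run] using ih

/-- Outputs are causal: longer runs only append. This lets a block decoder recover the stopping
moment from a longer output sequence. -/
theorem outputs_take (enc : List X → X) (s₀ : X) (ω : ℕ → Bool) {k t : ℕ} (h : k ≤ t) :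
    (outputs enc s₀ ω t).take k = outputs enc s₀ ω k := by
  induction t, h using Nat.le_induction with
  | base => exact List.take_of_length_le (outputs_length enc s₀ ω k).le
  | succ t hkt ih =>
    have : outputs enc s₀ ω (t + 1) = outputs enc s₀ ω t ++
        [channelOut (ω t) (enc (run enc s₀ ω t).1) (run enc s₀ ω t).2] := by
      simp [outputs, run]
    rw [this, List.take_append_of_le_length (by rw [outputs_length]; exact hkt), ih]

@[simp]
theorem channelOut_self (b : Bool) (x : X) : channelOut b x x = x := by
  simp [channelOut]

theorem VarCode.StopsWith.time_eq {M : Type*} {C : VarCode M X} {s₀ : X} {m m' : M}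
    {ω : ℕ → Bool} {t : ℕ} (h : C.StopsWith s₀ m ω t m') : C.time s₀ m ω = t := by
  apply le_antisymm
  · exact sInf_le ⟨t, rfl, by simp [h.1]⟩
  · refine le_sInf ?_
    rintro _ ⟨k, rfl, hk⟩
    by_contra hlt
    exact hk (h.2 k (by simpa using hlt))

end Channel

/-! ### Zero-error decoding of the scheme. -/

section Scheme

variable {X : Type*} [DecidableEq X]

/-- The number of channel uses for the symbols `vs`, when `u` was completed last. -/
def restTime : X → List X → (ℕ → Bool) → ℕ
  | _, [], _ => 0
  | u, v :: vs, ω =>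
    if v ≠ u ∧ ω 0 = true then restTime v vs (fun i => ω (i + 1)) + 1
    else restTime v vs (fun i => ω (i + 2)) + 2

/-- The number of changes of symbol in `u :: vs`. -/
def changes : X → List X → ℕ
  | _, [] => 0
  | u, v :: vs => changes v vs + if v = u then 0 else 1

theorem restTime_le (u : X) (vs : List X) (ω : ℕ → Bool) :
    restTime u vs ω ≤ 2 * vs.length := by
  induction vs generalizing u ω with
  | nil => simp [restTime]
  | cons v vs ih =>
    rw [restTime, List.length_cons]
    split_ifs
    · have := ih v (fun i => ω (i + 1)); omega
    · have := ih v (fun i => ω (i + 2)); omega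

theorem decodeRest_cons_of_ne {u v : X} (h : v ≠ u) (ys : List X) :
    decodeRest u (v :: ys) = v :: decodeRest v ys := by
  cases ys <;> simp [decodeRest, h]

theorem decodeRest_cons_cons_self (u v : X) (ys : List X) :
    decodeRest u (u :: v :: ys) = v :: decodeRest v ys := by
  simp [decodeRest]

theorem outputs_encodeRest_of_fresh {u v : X} (vs : List X) {ω : ℕ → Bool}
    (h : v ≠ u ∧ ω 0 = true) (t : ℕ) :
    outputs (encodeRest u (v :: vs)) u ω (t + 1) =
      v :: outputs (encodeRest v vs) v (fun i => ω (i + 1)) t := by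
  have h0 : channelOut (ω 0) v u = v := by simp [channelOut, h.2]
  have h1 : (fun ys => encodeRest u (v :: vs) (v :: ys)) = encodeRest v vs := by
    funext ys; simp [encodeRest, h.1]
  have h2 : encodeRest u (v :: vs) [] = v := rfl
  rw [outputs_succ_eq_cons]
  simp only [h2, h0, h1]

/-- A repeated symbol and a change hidden by the coin look alike: the first output is the state `u`;
then input and state are both `v`, so the second output does not depend on the coin. -/
theorem outputs_encodeRest_of_not_fresh {u v : X} (vs : List X) {ω : ℕ → Bool}
    (h : ¬(v ≠ u ∧ ω 0 = true)) (t : ℕ) :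
    outputs (encodeRest u (v :: vs)) u ω (t + 2) =
      u :: v :: outputs (encodeRest v vs) v (fun i => ω (i + 2)) t := by
  have h0 : channelOut (ω 0) v u = u := by
    by_cases hv : v = u
    · simp [hv]
    · simp [channelOut, show ω 0 = false by simpa [hv] using h]
  have hu : ¬(v ≠ u ∧ u = v) := fun hh => hh.1 hh.2.symm
  have h1 : encodeRest u (v :: vs) [u] = v := by simp only [encodeRest, if_neg hu]
  have h2 : (fun ys => encodeRest u (v :: vs) (u :: v :: ys)) = encodeRest v vs := by
    funext ys; simp only [encodeRest, if_neg hu]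
  rw [outputs_succ_eq_cons, outputs_succ_eq_cons]
  have h3 : encodeRest u (v :: vs) [] = v := rfl
  simp only [h3, h0, h1, channelOut_self, h2]

theorem outputs_encodeRest_one_of_not_fresh {u v : X} (vs : List X) {ω : ℕ → Bool}
    (h : ¬(v ≠ u ∧ ω 0 = true)) :
    outputs (encodeRest u (v :: vs)) u ω 1 = [u] := by
  rw [← outputs_take _ _ _ (show 1 ≤ 0 + 2 by simp), outputs_encodeRest_of_not_fresh vs h]
  rfl

theorem decodeRest_restTime (u : X) (vs : List X) (ω : ℕ → Bool) :
    decodeRest u (outputs (encodeRest u vs) u ω (restTime u vs ω)) = vs := by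
  induction vs generalizing u ω with
  | nil => simp [restTime, outputs, run, decodeRest]
  | cons v vs ih =>
    by_cases h : v ≠ u ∧ ω 0 = true
    · rw [restTime, if_pos h, outputs_encodeRest_of_fresh vs h, decodeRest_cons_of_ne h.1, ih]
    · rw [restTime, if_neg h, outputs_encodeRest_of_not_fresh vs h, decodeRest_cons_cons_self, ih]

/-- Excludes early stopping: all message streams have the same length, so a shorter decoded list
matches none of them. -/
theorem length_decodeRest_lt (u : X) (vs : List X) (ω : ℕ → Bool) {k : ℕ}
    (hk : k < restTime u vs ω) :
    (decodeRest u (outputs (encodeRest u vs) u ω k)).length < vs.length := by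
  induction vs generalizing u ω k with
  | nil => simp [restTime] at hk
  | cons v vs ih =>
    by_cases h : v ≠ u ∧ ω 0 = true
    · rw [restTime, if_pos h] at hk
      cases k with
      | zero => simp [outputs, run, decodeRest]
      | succ k =>
        rw [outputs_encodeRest_of_fresh vs h, decodeRest_cons_of_ne h.1]
        simpa using ih v _ (Nat.lt_of_succ_lt_succ hk)
    · rw [restTime, if_neg h] at hk
      match k, hk with
      | 0, _ => simp [outputs, run, decodeRest]
      | 1, _ => simp [outputs_encodeRest_one_of_not_fresh vs h, decodeRest]
      | k + 2, hk =>
        rw [outputs_encodeRest_of_not_fresh vs h, decodeRest_cons_cons_self]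
        simpa using ih v _ (show k < _ by omega)

/-- The number of channel uses of the scheme for the stream `ν`. -/
def streamTime {N : ℕ} (ν : Fin (N + 1) → X) (ω : ℕ → Bool) : ℕ :=
  restTime (ν 0) (List.ofFn (Fin.tail ν)) (fun i => ω (i + 2)) + 2

theorem streamTime_le {N : ℕ} (ν : Fin (N + 1) → X) (ω : ℕ → Bool) :
    streamTime ν ω ≤ 2 * (N + 1) := by
  have := restTime_le (ν 0) (List.ofFn (Fin.tail ν)) (fun i => ω (i + 2))
  rw [List.length_ofFn] at this
  rw [streamTime]; omega

theorem outputs_schemeEncode {N : ℕ} (ν : Fin (N + 1) → X) (s₀ : X) (ω : ℕ → Bool) (t : ℕ) :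
    outputs (schemeEncode ν) s₀ ω (t + 2) = channelOut (ω 0) (ν 0) s₀ :: ν 0 ::
      outputs (encodeRest (ν 0) (List.ofFn (Fin.tail ν))) (ν 0) (fun i => ω (i + 2)) t := by
  rw [outputs_succ_eq_cons, outputs_succ_eq_cons]
  simp [schemeEncode]

theorem schemeDecode_streamTime {N : ℕ} (ν : Fin (N + 1) → X) (s₀ : X) (ω : ℕ → Bool) :
    schemeDecode (outputs (schemeEncode ν) s₀ ω (streamTime ν ω)) = List.ofFn ν := by
  rw [streamTime, outputs_schemeEncode, schemeDecode, decodeRest_restTime, List.ofFn_succ]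
  rfl

theorem length_schemeDecode_lt {N : ℕ} (ν : Fin (N + 1) → X) (s₀ : X) (ω : ℕ → Bool) {k : ℕ}
    (hk : k < streamTime ν ω) :
    (schemeDecode (outputs (schemeEncode ν) s₀ ω k)).length < N + 1 := by
  match k, hk with
  | 0, _ => simp [outputs, run, schemeDecode]
  | 1, _ => simp [outputs, run, schemeDecode]
  | k + 2, hk =>
    rw [streamTime] at hk
    have := length_decodeRest_lt (ν 0) (List.ofFn (Fin.tail ν)) (fun i => ω (i + 2))
      (show k < _ by omega)
    rw [List.length_ofFn] at this
    rw [outputs_schemeEncode, schemeDecode, List.length_cons]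
    omega

theorem schemeCode_decide_eq_none {M : Type*} {N : ℕ} (φ : M → Fin (N + 1) → X) {ys : List X}
    (h : (schemeDecode ys).length < N + 1) : (schemeCode φ).decide ys = none := by
  refine dif_neg ?_
  rintro ⟨m, hm⟩
  rw [← hm, List.length_ofFn] at h
  exact lt_irrefl _ h

theorem schemeCode_decide_eq_some {M : Type*} {N : ℕ} {φ : M → Fin (N + 1) → X}
    (hφ : Function.Injective φ) {ys : List X} {m : M} (h : schemeDecode ys = List.ofFn (φ m)) :
    (schemeCode φ).decide ys = some m := by
  have hex : ∃ m, List.ofFn (φ m) = schemeDecode ys := ⟨m, h.symm⟩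
  refine (dif_pos hex).trans (congrArg some (hφ (List.ofFn_injective ?_)))
  exact hex.choose_spec.trans h

theorem schemeCode_stopsWith {M : Type*} {N : ℕ} {φ : M → Fin (N + 1) → X}
    (hφ : Function.Injective φ) (s₀ : X) (m : M) (ω : ℕ → Bool) :
    (schemeCode φ).StopsWith s₀ m ω (streamTime (φ m) ω) m :=
  ⟨schemeCode_decide_eq_some hφ (schemeDecode_streamTime (φ m) s₀ ω),
    fun _ hk => schemeCode_decide_eq_none φ (length_schemeDecode_lt (φ m) s₀ ω hk)⟩

theorem schemeCode_zeroErrorWithin {M : Type*} {N : ℕ} {φ : M → Fin (N + 1) → X}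
    (hφ : Function.Injective φ) : (schemeCode φ).ZeroErrorWithin (2 * (N + 1)) :=
  fun s₀ m ω => ⟨_, streamTime_le (φ m) ω, schemeCode_stopsWith hφ s₀ m ω⟩

theorem schemeCode_time {M : Type*} {N : ℕ} {φ : M → Fin (N + 1) → X}
    (hφ : Function.Injective φ) (s₀ : X) (m : M) (ω : ℕ → Bool) :
    (schemeCode φ).time s₀ m ω = streamTime (φ m) ω :=
  (schemeCode_stopsWith hφ s₀ m ω).time_eq

end Scheme

/-! ### Conditioning on the first coin, and shift invariance. -/

section Coins

instance : IsProbabilityMeasure coinLaw := by unfold coinLaw; infer_instance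

/-- Prepend a coin to a sequence of coins. -/
def consCoin (b : Bool) (ω : ℕ → Bool) : ℕ → Bool
  | 0 => b
  | n + 1 => ω n

theorem measurable_consCoin (b : Bool) : Measurable (consCoin b) := by
  rw [measurable_pi_iff]
  rintro (_ | n)
  · exact measurable_const
  · exact measurable_pi_apply n

theorem uniformBool_apply (B : Set Bool) :
    (PMF.uniformOfFintype Bool).toMeasure B =
      2⁻¹ * B.indicator 1 true + 2⁻¹ * B.indicator 1 false := by
  classical
  rw [PMF.toMeasure_apply_fintype]
  simp only [Set.indicator_apply, Fintype.sum_bool, PMF.uniformOfFintype_apply, Fintype.card_bool]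
  simp

theorem consCoin_preimage_pi (b : Bool) (s : Finset ℕ) (t : ℕ → Set Bool) :
    consCoin b ⁻¹' (s : Set ℕ).pi t =
      {_ω | 0 ∈ s → b ∈ t 0} ∩
        ((s.preimage Nat.succ (Nat.succ_injective.injOn) : Finset ℕ) : Set ℕ).pi
          (fun i => t (i + 1)) := by
  ext ω
  simp only [Set.mem_preimage, Set.mem_pi, Set.mem_inter_iff, Set.mem_ofPred_eq, Finset.mem_coe,
    Finset.mem_preimage]
  constructor
  · exact fun h => ⟨h 0, fun i hi => h (i + 1) hi⟩
  · rintro ⟨h0, h1⟩ (_ | i) hi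
    · exact h0 hi
    · exact h1 i hi

theorem coinLaw_consCoin_preimage_pi (b : Bool) (s : Finset ℕ) (t : ℕ → Set Bool) :
    coinLaw (consCoin b ⁻¹' (s : Set ℕ).pi t) =
      (if 0 ∈ s then (t 0).indicator 1 b else 1) *
        ∏ i ∈ s.preimage Nat.succ (Nat.succ_injective.injOn),
          (PMF.uniformOfFintype Bool).toMeasure (t (i + 1)) := by
  classical
  have hpi := Measure.infinitePi_pi (fun _ : ℕ => (PMF.uniformOfFintype Bool).toMeasure)
    (s := s.preimage Nat.succ (Nat.succ_injective.injOn)) (t := fun i => t (i + 1))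
    (fun i _ => MeasurableSet.of_discrete)
  rw [consCoin_preimage_pi]
  by_cases h : 0 ∈ s → b ∈ t 0
  · have hset : {_ω : ℕ → Bool | 0 ∈ s → b ∈ t 0} = Set.univ := by
      ext; simpa using h
    rw [hset, Set.univ_inter, coinLaw, hpi]
    by_cases h0 : 0 ∈ s
    · simp [h0, h h0]
    · simp [h0]
  · have hset : {_ω : ℕ → Bool | 0 ∈ s → b ∈ t 0} = ∅ := by
      ext; simpa using h
    push Not at h
    rw [hset]
    simp [h.1, h.2]

/-- A sequence of fair coins is a fair coin followed by a sequence of fair coins. -/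
theorem coinLaw_eq_consCoin :
    coinLaw = (2⁻¹ : ENNReal) • coinLaw.map (consCoin true) +
      (2⁻¹ : ENNReal) • coinLaw.map (consCoin false) := by
  symm
  -- The product measure is determined by finite cylinders; on these the mixture over the first coin
  -- supplies the factor at index 0, and the shifted cylinder the other factors.
  refine Measure.eq_infinitePi _ fun s t _ => ?_
  have hm : MeasurableSet ((s : Set ℕ).pi t) :=
    .pi s.countable_toSet fun _ _ => MeasurableSet.of_discrete
  simp only [Measure.coe_add, Measure.coe_smul, Pi.add_apply, Pi.smul_apply, smul_eq_mul]
  rw [Measure.map_apply (measurable_consCoin _) hm, Measure.map_apply (measurable_consCoin _) hm,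
    coinLaw_consCoin_preimage_pi, coinLaw_consCoin_preimage_pi]
  by_cases h0 : 0 ∈ s
  · have hs : s = insert 0 ((s.preimage Nat.succ (Nat.succ_injective.injOn)).map
        ⟨Nat.succ, Nat.succ_injective⟩) := by
      ext (_ | i) <;> simp [h0]
    conv_rhs => rw [hs]
    rw [Finset.prod_insert (by simp), Finset.prod_map, uniformBool_apply]
    simp only [h0, if_true, Function.Embedding.coeFn_mk, Nat.succ_eq_add_one]
    ring
  · have hs : s = (s.preimage Nat.succ (Nat.succ_injective.injOn)).map
        ⟨Nat.succ, Nat.succ_injective⟩ := by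
      ext (_ | i) <;> simp [h0]
    conv_rhs => rw [hs]
    rw [Finset.prod_map]
    simp only [h0, if_false, Function.Embedding.coeFn_mk, Nat.succ_eq_add_one, one_mul]
    rw [← add_mul, ENNReal.inv_two_add_inv_two, one_mul]

theorem lintegral_coinLaw {f : (ℕ → Bool) → ENNReal} (hf : Measurable f) :
    ∫⁻ ω, f ω ∂coinLaw = 2⁻¹ * ∫⁻ ω, f (consCoin true ω) ∂coinLaw +
      2⁻¹ * ∫⁻ ω, f (consCoin false ω) ∂coinLaw := by
  conv_lhs => rw [coinLaw_eq_consCoin]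
  rw [lintegral_add_measure, lintegral_smul_measure, lintegral_smul_measure,
    lintegral_map hf (measurable_consCoin _), lintegral_map hf (measurable_consCoin _)]
  simp only [smul_eq_mul]

theorem measurable_shift (k : ℕ) : Measurable fun (ω : ℕ → Bool) (i : ℕ) => ω (i + k) :=
  measurable_pi_iff.2 fun i => measurable_pi_apply (i + k)

/-- After conditioning on the first coin, the two halves are equal, because a shifted sequence
ignores that coin. -/
theorem lintegral_coinLaw_shift {f : (ℕ → Bool) → ENNReal} (hf : Measurable f) (k : ℕ) :
    ∫⁻ ω, f (fun i => ω (i + k)) ∂coinLaw = ∫⁻ ω, f ω ∂coinLaw := by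
  induction k with
  | zero => rfl
  | succ k ih =>
    refine (lintegral_coinLaw (hf.comp (measurable_shift (k + 1)))).trans ?_
    rw [← ih, ← one_mul (∫⁻ ω, f (fun i => ω (i + k)) ∂coinLaw), ← ENNReal.inv_two_add_inv_two,
      add_mul]
    rfl

end Coins

/-! ### Mean and variance of the number of channel uses. -/

section Time

variable {X : Type*} [DecidableEq X]

theorem measurable_restTime (u : X) (vs : List X) : Measurable (restTime u vs) := by
  induction vs generalizing u with
  | nil => exact measurable_const
  | cons v vs ih =>
    have : restTime u (v :: vs) = fun ω => if v ≠ u ∧ ω 0 = true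
        then restTime v vs (fun i => ω (i + 1)) + 1
        else restTime v vs (fun i => ω (i + 2)) + 2 := by
      funext ω; rw [restTime]
    rw [this]
    refine Measurable.ite ?_ (((ih v).comp (measurable_shift 1)).add_const 1)
      (((ih v).comp (measurable_shift 2)).add_const 2)
    by_cases h : v = u
    · simp [h]
    · simpa [h] using measurableSet_eq_fun (measurable_pi_apply 0) measurable_const

theorem measurable_streamTime {N : ℕ} (ν : Fin (N + 1) → X) : Measurable (streamTime ν) :=
  ((measurable_restTime _ _).comp (measurable_shift 2)).add_const 2

/-- The expectation of `F` at the number of channel uses for the symbols `vs`. -/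
noncomputable def restExp : X → List X → (ℕ → ℝ) → ℝ
  | _, [], F => F 0
  | u, v :: vs, F =>
    if v = u then restExp v vs (fun t => F (t + 2))
    else (restExp v vs (fun t => F (t + 1)) + restExp v vs (fun t => F (t + 2))) / 2

theorem restExp_nonneg (u : X) (vs : List X) {F : ℕ → ℝ} (hF : ∀ t, 0 ≤ F t) :
    0 ≤ restExp u vs F := by
  induction vs generalizing u F with
  | nil => exact hF 0
  | cons v vs ih =>
    rw [restExp]
    have h1 := ih v (F := fun t => F (t + 1)) fun t => hF _
    have h2 := ih v (F := fun t => F (t + 2)) fun t => hF _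
    split_ifs <;> linarith

/-- A general `F` makes the induction work, since peeling off a symbol translates the argument of
`F`; it also serves both the mean and the second moment. -/
theorem lintegral_restTime (u : X) (vs : List X) {F : ℕ → ℝ} (hF : ∀ t, 0 ≤ F t) :
    ∫⁻ ω, ENNReal.ofReal (F (restTime u vs ω)) ∂coinLaw = ENNReal.ofReal (restExp u vs F) := by
  induction vs generalizing u F with
  | nil => simp [restTime, restExp]
  | cons v vs ih =>
    have hmeas (G : ℕ → ℝ) (w : X) (ws : List X) :
        Measurable fun ω => ENNReal.ofReal (G (restTime w ws ω)) :=
      (measurable_of_countable fun t : ℕ => ENNReal.ofReal (G t)).comp (measurable_restTime w ws)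
    by_cases h : v = u
    · have h1 : ∀ ω, restTime u (v :: vs) ω = restTime v vs (fun i => ω (i + 2)) + 2 := by
        intro ω; rw [restTime, if_neg (by simp [h])]
      simp only [h1]
      rw [restExp, if_pos h, ← ih v (F := fun t => F (t + 2)) fun t => hF _]
      exact lintegral_coinLaw_shift (hmeas (fun t => F (t + 2)) v vs) 2
    · have h1 : ∀ ω, restTime u (v :: vs) (consCoin true ω) = restTime v vs ω + 1 := by
        intro ω; rw [restTime, if_pos ⟨h, rfl⟩]; rfl
      have h2 : ∀ ω, restTime u (v :: vs) (consCoin false ω) =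
          restTime v vs (fun i => ω (i + 1)) + 2 := by
        intro ω; rw [restTime, if_neg (by simp [consCoin])]; rfl
      rw [lintegral_coinLaw (hmeas F u (v :: vs))]
      simp only [h1, h2]
      rw [lintegral_coinLaw_shift (hmeas (fun t => F (t + 2)) v vs) 1,
        ih v (F := fun t => F (t + 1)) fun t => hF _,
        ih v (F := fun t => F (t + 2)) fun t => hF _, restExp, if_neg h, ← mul_add,
        ← ENNReal.ofReal_add (restExp_nonneg _ _ fun t => hF _)
          (restExp_nonneg _ _ fun t => hF _), div_eq_inv_mul, ENNReal.ofReal_mul (by norm_num),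
        ENNReal.ofReal_inv_of_pos (by norm_num)]
      simp

theorem restExp_add_const (u : X) (vs : List X) (c : ℝ) :
    restExp u vs (fun t => (t : ℝ) + c) = 2 * vs.length - changes u vs / 2 + c := by
  induction vs generalizing u c with
  | nil => simp [restExp, changes]
  | cons v vs ih =>
    have h1 := ih v (1 + c)
    have h2 := ih v (2 + c)
    simp only [restExp, changes, Nat.cast_add, List.length_cons, Nat.cast_one, Nat.cast_ofNat,
      add_assoc]
    rw [h1, h2]
    split_ifs <;> push_cast <;> ring

/-- Variance plus squared bias: a repeated symbol takes time 2, a change takes 1 or 2 with equal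
probability and so adds variance 1/4. Keeping `c` free absorbs the translations in the induction. -/
theorem restExp_sub_sq (u : X) (vs : List X) (c : ℝ) :
    restExp u vs (fun t => ((t : ℝ) - c) ^ 2) =
      changes u vs / 4 + (2 * vs.length - changes u vs / 2 - c) ^ 2 := by
  induction vs generalizing u c with
  | nil => simp [restExp, changes]
  | cons v vs ih =>
    have h1 : restExp v vs (fun t => (((t + 1 : ℕ) : ℝ) - c) ^ 2) = _ :=
      (congrArg _ (funext fun t => by push_cast; ring)).trans (ih v (c - 1))
    have h2 : restExp v vs (fun t => (((t + 2 : ℕ) : ℝ) - c) ^ 2) = _ :=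
      (congrArg _ (funext fun t => by push_cast; ring)).trans (ih v (c - 2))
    simp only [restExp, changes, List.length_cons]
    rw [h1, h2]
    split_ifs <;> push_cast <;> ring

/-- The number of changes of symbol in a stream. -/
def streamChanges {N : ℕ} (ν : Fin (N + 1) → X) : ℕ :=
  ∑ i : Fin N, if ν i.succ = ν i.castSucc then 0 else 1

theorem changes_ofFn {N : ℕ} (ν : Fin (N + 1) → X) :
    changes (ν 0) (List.ofFn (Fin.tail ν)) = streamChanges ν := by
  induction N with
  | zero => simp [changes, streamChanges]
  | succ N ih =>
    rw [List.ofFn_succ, changes, streamChanges, Fin.sum_univ_succ, add_comm]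
    refine congrArg₂ _ rfl ?_
    exact ih (Fin.tail ν)

theorem streamChanges_le {N : ℕ} (ν : Fin (N + 1) → X) : streamChanges ν ≤ N := by
  calc streamChanges ν ≤ ∑ _i : Fin N, 1 := Finset.sum_le_sum fun i _ => by split_ifs <;> simp
    _ = N := by simp

/-- The expected number of channel uses for a stream of length `N + 1` with `d` changes. -/
noncomputable def meanTime (N d : ℕ) : ℝ := 2 + 2 * N - d / 2

theorem schemeCode_expectedTime {M : Type*} {N : ℕ} {φ : M → Fin (N + 1) → X}
    (hφ : Function.Injective φ) (s₀ : X) (m : M) :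
    (schemeCode φ).expectedTime s₀ m = meanTime N (streamChanges (φ m)) := by
  have hF : ∀ t : ℕ, (0 : ℝ) ≤ (t : ℝ) + 2 := fun t => by positivity
  have h := lintegral_restTime (φ m 0) (List.ofFn (Fin.tail (φ m))) hF
  have hmeas : Measurable fun ω =>
      ENNReal.ofReal ((restTime (φ m 0) (List.ofFn (Fin.tail (φ m))) ω : ℝ) + 2) :=
    (measurable_of_countable fun t : ℕ => ENNReal.ofReal ((t : ℝ) + 2)).comp
      (measurable_restTime _ _)
  have hint : ∫⁻ ω, ((schemeCode φ).time s₀ m ω : ENNReal) ∂coinLaw =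
      ∫⁻ ω, ENNReal.ofReal ((restTime (φ m 0) (List.ofFn (Fin.tail (φ m)))
        (fun i => ω (i + 2)) : ℝ) + 2) ∂coinLaw := by
    refine lintegral_congr fun ω => ?_
    rw [schemeCode_time hφ, streamTime, ENat.toENNReal_coe, ← ENNReal.ofReal_natCast]
    push_cast
    rfl
  rw [VarCode.expectedTime, hint, lintegral_coinLaw_shift hmeas 2, h,
    ENNReal.toReal_ofReal (restExp_nonneg _ _ hF), restExp_add_const, changes_ofFn,
    List.length_ofFn, meanTime]
  ring

/-- Chebyshev's inequality for the number of channel uses. -/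
theorem coinLaw_lt_streamTime_le {N : ℕ} (ν : Fin (N + 1) → X) {T : ℕ}
    (hT : meanTime N (streamChanges ν) < T) :
    (coinLaw {ω | T < streamTime ν ω}).toReal ≤
      N / (4 * (T - meanTime N (streamChanges ν)) ^ 2) := by
  set μ := meanTime N (streamChanges ν) with hμ
  -- The first symbol takes exactly two uses, so the remaining time is centred at `μ - 2`.
  have hF : ∀ t : ℕ, (0 : ℝ) ≤ ((t : ℝ) - (μ - 2)) ^ 2 := fun t => sq_nonneg _
  have hmeas : Measurable fun ω =>
      ENNReal.ofReal (((restTime (ν 0) (List.ofFn (Fin.tail ν)) ω : ℝ) - (μ - 2)) ^ 2) :=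
    (measurable_of_countable fun t : ℕ => ENNReal.ofReal (((t : ℝ) - (μ - 2)) ^ 2)).comp
      (measurable_restTime _ _)
  have hvar : ∫⁻ ω, ENNReal.ofReal (((streamTime ν ω : ℝ) - μ) ^ 2) ∂coinLaw =
      ENNReal.ofReal (streamChanges ν / 4) := by
    have h := lintegral_restTime (ν 0) (List.ofFn (Fin.tail ν)) hF
    rw [← lintegral_coinLaw_shift hmeas 2, restExp_sub_sq, changes_ofFn, List.length_ofFn] at h
    have e : (2 * N - streamChanges ν / 2 - (μ - 2) : ℝ) = 0 := by rw [hμ, meanTime]; ring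
    rw [e, zero_pow two_ne_zero, add_zero] at h
    rw [← h]
    refine lintegral_congr fun ω => ?_
    rw [streamTime]
    push_cast
    congr 2
    ring
  have hpos : 0 < ((T : ℝ) - μ) ^ 2 := by have := sub_pos.2 hT; positivity
  have hmeas' : Measurable fun ω => ENNReal.ofReal (((streamTime ν ω : ℝ) - μ) ^ 2) :=
    (measurable_of_countable fun t : ℕ => ENNReal.ofReal (((t : ℝ) - μ) ^ 2)).comp
      (measurable_streamTime ν)
  have hle : coinLaw {ω | T < streamTime ν ω} ≤
      ENNReal.ofReal (streamChanges ν / 4) / ENNReal.ofReal (((T : ℝ) - μ) ^ 2) := by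
    refine le_trans (measure_mono ?_) ((meas_ge_le_lintegral_div hmeas'.aemeasurable
      (ENNReal.ofReal_pos.2 hpos).ne' ENNReal.ofReal_ne_top).trans_eq (by rw [hvar]))
    intro ω hω
    have hω' : (T : ℝ) < streamTime ν ω := by exact_mod_cast hω
    refine ENNReal.ofReal_le_ofReal ?_
    have := sub_pos.2 hT
    gcongr
  rw [← ENNReal.ofReal_div_of_pos hpos] at hle
  refine (ENNReal.toReal_le_of_le_ofReal (by positivity) hle).trans ?_
  rw [div_div]
  gcongr
  exact streamChanges_le ν

end Time

/-! ### The Markov stream: entropy, mean time, number of changes. -/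

section Markov

variable {X : Type*}

/-- Streams are extended at the end because the law of the next symbol depends only on the last one;
all inductions over the Markov law use this splitting. -/
theorem sum_snoc [Fintype X] {N : ℕ} (f : (Fin (N + 2) → X) → ℝ) :
    ∑ ν, f ν = ∑ ν : Fin (N + 1) → X, ∑ x, f (Fin.snoc (α := fun _ => X) ν x) := by
  rw [← (Fin.snocEquiv fun _ : Fin (N + 2) => X).sum_comp, Fintype.sum_prod_type,
    Finset.sum_comm]
  rfl

theorem snoc_pair {N : ℕ} (ν : Fin (N + 1) → X) (x : X) (i : Fin N) :
    (Fin.snoc (α := fun _ => X) ν x : Fin (N + 2) → X) i.castSucc.castSucc = ν i.castSucc ∧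
    (Fin.snoc (α := fun _ => X) ν x : Fin (N + 2) → X) i.castSucc.succ = ν i.succ := by
  constructor
  · rw [Fin.snoc_castSucc]
  · rw [Fin.succ_castSucc, Fin.snoc_castSucc]

theorem snoc_last_pair {N : ℕ} (ν : Fin (N + 1) → X) (x : X) :
    (Fin.snoc (α := fun _ => X) ν x : Fin (N + 2) → X) (Fin.last N).castSucc = ν (Fin.last N) ∧
    (Fin.snoc (α := fun _ => X) ν x : Fin (N + 2) → X) (Fin.last N).succ = x := by
  constructor
  · rw [Fin.snoc_castSucc]
  · rw [Fin.succ_last, Fin.snoc_last]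

variable [DecidableEq X]

theorem streamChanges_snoc {N : ℕ} (ν : Fin (N + 1) → X) (x : X) :
    streamChanges (Fin.snoc (α := fun _ => X) ν x : Fin (N + 2) → X) =
      streamChanges ν + if x = ν (Fin.last N) then 0 else 1 := by
  rw [streamChanges, Fin.sum_univ_castSucc]
  simp only [snoc_pair, snoc_last_pair]
  rfl

theorem streamChanges_cast {N : ℕ} (ν : Fin (N + 1) → X) :
    (streamChanges ν : ℝ) = ∑ i : Fin N, if ν i.succ = ν i.castSucc then 0 else 1 := by
  simp [streamChanges]

variable [Fintype X]

theorem markovLaw_snoc (p : ℝ) {N : ℕ} (ν : Fin (N + 1) → X) (x : X) :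
    markovLaw p (N + 1) (Fin.snoc (α := fun _ => X) ν x : Fin (N + 2) → X) =
      markovLaw p N ν * transition p (ν (Fin.last N)) x := by
  rw [markovLaw, Fin.prod_univ_castSucc]
  simp only [snoc_pair, snoc_last_pair]
  rw [markovLaw, mul_assoc]

/-- The one-step functionals of interest see only whether the symbol changes. Their conditional mean
is therefore independent of `u`, which is the hypothesis of `sum_markovLaw_mul_sum`. -/
theorem sum_transition_mul_ite (hX : 2 ≤ Fintype.card X) (p : ℝ) (u : X) (a b : ℝ) :
    ∑ v, transition p u v * (if v = u then a else b) = p * a + (1 - p) * b := by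
  have hm : (Fintype.card X : ℝ) - 1 ≠ 0 := by
    have : (2 : ℝ) ≤ Fintype.card X := by exact_mod_cast hX
    linarith
  rw [← Finset.add_sum_erase _ _ (Finset.mem_univ u)]
  have h : ∀ v ∈ Finset.univ.erase u, transition p u v * (if v = u then a else b) =
      (1 - p) / ((Fintype.card X : ℝ) - 1) * b := by
    intro v hv
    have := Finset.ne_of_mem_erase hv
    simp [transition, this]
  rw [Finset.sum_congr rfl h, Finset.sum_const, Finset.card_erase_of_mem (Finset.mem_univ u),
    Finset.card_univ, nsmul_eq_mul, Nat.cast_sub (by omega)]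
  simp only [transition, if_true, Nat.cast_one]
  field_simp

theorem sum_transition (hX : 2 ≤ Fintype.card X) (p : ℝ) (u : X) :
    ∑ v, transition p u v = 1 := by
  simpa using sum_transition_mul_ite hX p u 1 1

theorem sum_markovLaw (hX : 2 ≤ Fintype.card X) (p : ℝ) (N : ℕ) :
    ∑ ν : Fin (N + 1) → X, markovLaw p N ν = 1 := by
  induction N with
  | zero =>
    have : (Fintype.card X : ℝ) ≠ 0 := by positivity
    simp [markovLaw, this]
  | succ N ih =>
    rw [sum_snoc]
    simp only [markovLaw_snoc]
    simp_rw [← Finset.mul_sum, sum_transition hX, mul_one]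
    exact ih

/-- The expectation of an additive functional of the Markov stream whose conditional expectation
at each step is constant. -/
theorem sum_markovLaw_mul_sum (hX : 2 ≤ Fintype.card X) (p : ℝ) (g : X → X → ℝ) (c : ℝ)
    (hg : ∀ u, ∑ v, transition p u v * g u v = c) (N : ℕ) :
    ∑ ν : Fin (N + 1) → X, markovLaw p N ν * ∑ i : Fin N, g (ν i.castSucc) (ν i.succ) =
      N * c := by
  induction N with
  | zero => simp
  | succ N ih =>
    rw [sum_snoc]
    have h : ∀ ν : Fin (N + 1) → X, ∑ x, markovLaw p (N + 1)
        (Fin.snoc (α := fun _ => X) ν x : Fin (N + 2) → X) *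
        ∑ i : Fin (N + 1), g ((Fin.snoc (α := fun _ => X) ν x : Fin (N + 2) → X) i.castSucc)
          ((Fin.snoc (α := fun _ => X) ν x : Fin (N + 2) → X) i.succ) =
        markovLaw p N ν * (∑ i : Fin N, g (ν i.castSucc) (ν i.succ)) + markovLaw p N ν * c := by
      intro ν
      simp only [Fin.sum_univ_castSucc, snoc_pair, snoc_last_pair, markovLaw_snoc]
      rw [← hg (ν (Fin.last N))]
      conv_lhs => enter [2, x]; rw [mul_add, mul_right_comm, mul_assoc _ (transition _ _ _)]
      rw [Finset.sum_add_distrib, ← Finset.mul_sum, ← Finset.mul_sum, sum_transition hX,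
        mul_one]
    rw [Finset.sum_congr rfl fun ν _ => h ν, Finset.sum_add_distrib, ih, ← Finset.sum_mul,
      sum_markovLaw hX]
    push_cast
    ring

theorem sum_markovLaw_mul_expectedTime (hX : 2 ≤ Fintype.card X) (p : ℝ) (N : ℕ) (s₀ : X) :
    ∑ ν : Fin (N + 1) → X, markovLaw p N ν *
      (schemeCode (fun ν : Fin (N + 1) → X => ν)).expectedTime s₀ ν = 2 + N * symbolTime p := by
  have h := sum_markovLaw_mul_sum hX p (fun u v => if v = u then 0 else 1) (1 - p)
    (fun u => by rw [sum_transition_mul_ite hX]; ring) N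
  have e (ν : Fin (N + 1) → X) : markovLaw p N ν *
      (schemeCode (fun ν : Fin (N + 1) → X => ν)).expectedTime s₀ ν =
      (2 + 2 * N) * markovLaw p N ν - (1 / 2) * (markovLaw p N ν *
        ∑ i : Fin N, if ν i.succ = ν i.castSucc then 0 else 1) := by
    rw [schemeCode_expectedTime (φ := fun ν : Fin (N + 1) → X => ν) (fun _ _ h => h), meanTime,
      streamChanges_cast]
    ring
  rw [Finset.sum_congr rfl fun ν _ => e ν, Finset.sum_sub_distrib, ← Finset.mul_sum,
    ← Finset.mul_sum, h, sum_markovLaw hX, symbolTime]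
  ring

theorem sum_transition_mul_neg_logb (hX : 2 ≤ Fintype.card X) (p : ℝ) (u : X) :
    ∑ v, transition p u v * (-Real.logb 2 (transition p u v)) = symbolEntropy X p := by
  have hm : (Fintype.card X : ℝ) - 1 ≠ 0 := by
    have : (2 : ℝ) ≤ Fintype.card X := by exact_mod_cast hX
    linarith
  have h := sum_transition_mul_ite hX p u (-Real.logb 2 p)
    (-Real.logb 2 ((1 - p) / ((Fintype.card X : ℝ) - 1)))
  have e (v : X) : transition p u v * (-Real.logb 2 (transition p u v)) =
      transition p u v * (if v = u then -Real.logb 2 p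
        else -Real.logb 2 ((1 - p) / ((Fintype.card X : ℝ) - 1))) := by
    by_cases hv : v = u <;> simp [transition, hv]
  rw [Finset.sum_congr rfl fun v _ => e v, h, symbolEntropy, H₂]
  -- At `p = 1` the logarithm of the quotient cannot be split, but it carries the weight `1 - p =
  -- 0`.
  by_cases hp : 1 - p = 0
  · simp [hp]
  · rw [Real.logb_div hp hm]; ring

theorem entropy_markovLaw (hX : 2 ≤ Fintype.card X) (p : ℝ) (N : ℕ) :
    entropy (markovLaw (X := X) p N) =
      Real.logb 2 (Fintype.card X) + N * symbolEntropy X p := by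
  have hc : (Fintype.card X : ℝ) ≠ 0 := by positivity
  have h := sum_markovLaw_mul_sum hX p (fun u v => -Real.logb 2 (transition p u v)) _
    (sum_transition_mul_neg_logb hX p) N
  have e (ν : Fin (N + 1) → X) : markovLaw p N ν * Real.logb 2 (markovLaw p N ν) =
      -(Real.logb 2 (Fintype.card X) * markovLaw p N ν + markovLaw p N ν *
        ∑ i : Fin N, -Real.logb 2 (transition p (ν i.castSucc) (ν i.succ))) := by
    by_cases h0 : markovLaw p N ν = 0
    · simp [h0]
    · have hprod : ∏ i : Fin N, transition p (ν i.castSucc) (ν i.succ) ≠ 0 :=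
        right_ne_zero_of_mul h0
      have : Real.logb 2 (markovLaw p N ν) = -Real.logb 2 (Fintype.card X) +
          ∑ i : Fin N, Real.logb 2 (transition p (ν i.castSucc) (ν i.succ)) := by
        rw [markovLaw, Real.logb_mul (by positivity) hprod, one_div, Real.logb_inv,
          Real.logb_prod _ _ fun i hi => Finset.prod_ne_zero_iff.1 hprod i hi]
      rw [this, Finset.sum_neg_distrib]
      ring
  rw [entropy, Finset.sum_congr rfl fun ν _ => e ν, Finset.sum_neg_distrib,
    Finset.sum_add_distrib, ← Finset.mul_sum, h, sum_markovLaw hX]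
  ring

/-- The number of changes in the Markov stream is binomially distributed. -/
theorem sum_markovLaw_streamChanges (hX : 2 ≤ Fintype.card X) (p : ℝ) (N d : ℕ) :
    ∑ ν : Fin (N + 1) → X, (if streamChanges ν = d then markovLaw p N ν else 0) =
      (N.choose d : ℝ) * (1 - p) ^ d * p ^ (N - d) := by
  induction N generalizing d with
  | zero =>
    cases d with
    | zero => simpa [streamChanges] using sum_markovLaw hX p 0
    | succ d => simp [streamChanges]
  | succ N ih =>
    rw [sum_snoc]
    have h (ν : Fin (N + 1) → X) : ∑ x, (if streamChanges
        (Fin.snoc (α := fun _ => X) ν x : Fin (N + 2) → X) = d then markovLaw p (N + 1)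
          (Fin.snoc (α := fun _ => X) ν x : Fin (N + 2) → X) else 0) =
        p * (if streamChanges ν = d then markovLaw p N ν else 0) +
        (1 - p) * (if streamChanges ν + 1 = d then markovLaw p N ν else 0) := by
      rw [← sum_transition_mul_ite hX p (ν (Fin.last N))]
      refine Finset.sum_congr rfl fun x _ => ?_
      rw [streamChanges_snoc, markovLaw_snoc]
      by_cases hx : x = ν (Fin.last N)
      · simp only [hx, if_true, add_zero]; split_ifs <;> ring
      · simp only [hx, if_false]; split_ifs <;> ring
    rw [Finset.sum_congr rfl fun ν _ => h ν, Finset.sum_add_distrib, ← Finset.mul_sum,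
      ← Finset.mul_sum, ih]
    cases d with
    | zero => simp [pow_succ, mul_comm]
    | succ d =>
      simp only [Nat.add_right_cancel_iff]
      rw [ih, Nat.choose_succ_succ, Nat.succ_sub_succ]
      -- Pascal's rule. Truncated subtraction gives `N - d = (N - (d + 1)) + 1` only for `d + 1 ≤
      -- N`; otherwise the coefficient `N.choose (d + 1)` vanishes.
      rcases lt_or_ge N (d + 1) with hd | hd
      · rw [Nat.choose_eq_zero_of_lt hd]
        push_cast
        ring
      · obtain ⟨e, rfl⟩ := Nat.exists_eq_add_of_le hd
        rw [show d + 1 + e - (d + 1) = e by omega, show d + 1 + e - d = e + 1 by omega]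
        push_cast
        ring

/-- Minus the binary logarithm of the Markov probability of a stream of length `N + 1` with `d`
changes. -/
noncomputable def markovCost (X : Type*) [Fintype X] (p : ℝ) (N d : ℕ) : ℝ :=
  Real.logb 2 (Fintype.card X) - N * Real.logb 2 p -
    d * (Real.logb 2 ((1 - p) / ((Fintype.card X : ℝ) - 1)) - Real.logb 2 p)

theorem transition_pos (hX : 2 ≤ Fintype.card X) {p : ℝ} (hp : p ∈ Set.Ioo (0 : ℝ) 1) (u v : X) :
    0 < transition p u v := by
  have : (2 : ℝ) ≤ Fintype.card X := by exact_mod_cast hX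
  rw [transition]
  split_ifs
  · exact hp.1
  · exact div_pos (by linarith [hp.2]) (by linarith)

theorem markovLaw_pos (hX : 2 ≤ Fintype.card X) {p : ℝ} (hp : p ∈ Set.Ioo (0 : ℝ) 1) {N : ℕ}
    (ν : Fin (N + 1) → X) : 0 < markovLaw p N ν :=
  mul_pos (by positivity) (Finset.prod_pos fun _ _ => transition_pos hX hp _ _)

theorem logb_markovLaw (hX : 2 ≤ Fintype.card X) {p : ℝ} (hp : p ∈ Set.Ioo (0 : ℝ) 1) {N : ℕ}
    (ν : Fin (N + 1) → X) :
    Real.logb 2 (markovLaw p N ν) = -markovCost X p N (streamChanges ν) := by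
  have hc : (Fintype.card X : ℝ) ≠ 0 := by positivity
  have e (i : Fin N) : Real.logb 2 (transition p (ν i.castSucc) (ν i.succ)) =
      Real.logb 2 p + (if ν i.succ = ν i.castSucc then 0 else 1) *
        (Real.logb 2 ((1 - p) / ((Fintype.card X : ℝ) - 1)) - Real.logb 2 p) := by
    rw [transition]; split_ifs <;> ring
  rw [markovLaw, Real.logb_mul (by positivity)
    (Finset.prod_pos fun _ _ => transition_pos hX hp _ _).ne', one_div, Real.logb_inv,
    Real.logb_prod _ _ fun i _ => (transition_pos hX hp _ _).ne',
    Finset.sum_congr rfl fun i _ => e i, Finset.sum_add_distrib, ← Finset.sum_mul,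
    ← streamChanges_cast, markovCost]
  simp
  ring

end Markov

/-! ### A lower bound for the binomial mode. -/

section Binomial

/-- The ratio of consecutive binomial weights, cross-multiplied. The weights do not decrease from
`j` to `j + 1` exactly when `j + 1 ≤ (N + 1) q`, which puts a mode at `⌊(N + 1) q⌋`. -/
theorem binomial_step (N j : ℕ) (q : ℝ) (hj : j < N) :
    (N.choose (j + 1) : ℝ) * q ^ (j + 1) * (1 - q) ^ (N - (j + 1)) * ((j + 1) * (1 - q)) =
      (N.choose j : ℝ) * q ^ j * (1 - q) ^ (N - j) * ((N - j) * q) := by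
  have h : (N.choose (j + 1) : ℝ) * (j + 1) = N.choose j * (N - j) := by
    have := Nat.choose_succ_right_eq N j
    rw [← Nat.cast_sub hj.le]
    exact_mod_cast this
  rw [show N - j = N - (j + 1) + 1 by omega, pow_succ (1 - q)]
  linear_combination (q ^ (j + 1) * (1 - q) ^ (N - (j + 1)) * (1 - q)) * h

/-- The mode of the binomial distribution has probability at least `1 / (N + 1)`. -/
theorem one_le_mul_binomial_mode (N : ℕ) {q : ℝ} (hq : q ∈ Set.Ioo (0 : ℝ) 1) :
    1 ≤ (N + 1 : ℝ) * ((N.choose ⌊(N + 1) * q⌋₊ : ℝ) * q ^ ⌊(N + 1) * q⌋₊ *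
      (1 - q) ^ (N - ⌊(N + 1) * q⌋₊)) := by
  obtain ⟨hq0, hq1⟩ := hq
  set k := ⌊(N + 1) * q⌋₊ with hk
  set b : ℕ → ℝ := fun j => (N.choose j : ℝ) * q ^ j * (1 - q) ^ (N - j) with hb
  have hq1' : 0 < 1 - q := by linarith
  have hbnn : ∀ j, 0 ≤ b j := fun j => by positivity
  have hkN : k ≤ N := by
    have h1 : (k : ℝ) ≤ (N + 1) * q := Nat.floor_le (by positivity)
    have h2 : (k : ℝ) < N + 1 := h1.trans_lt (by nlinarith)
    exact Nat.lt_succ_iff.1 (by exact_mod_cast h2)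
  have hup : ∀ j < k, b j ≤ b (j + 1) := by
    intro j hj
    have hjq : (j + 1 : ℝ) ≤ (N + 1) * q :=
      le_trans (b := (k : ℝ)) (by exact_mod_cast hj) (Nat.floor_le (by positivity))
    have hs := binomial_step N j q (hj.trans_le hkN)
    have hle : ((j + 1) * (1 - q) : ℝ) ≤ (N - j) * q := by nlinarith
    refine le_of_mul_le_mul_right ?_ (show (0 : ℝ) < (j + 1) * (1 - q) by positivity)
    change _ ≤ (N.choose (j + 1) : ℝ) * q ^ (j + 1) * (1 - q) ^ (N - (j + 1)) * _
    rw [hs]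
    exact mul_le_mul_of_nonneg_left hle (hbnn j)
  have hdown : ∀ j, k ≤ j → b (j + 1) ≤ b j := by
    intro j hj
    rcases lt_or_ge j N with hjN | hjN
    · have hjq : (N + 1) * q < j + 1 := by
        have h1 := Nat.lt_floor_add_one ((N + 1) * q : ℝ)
        have h2 : (k : ℝ) ≤ j := by exact_mod_cast hj
        rw [← hk] at h1
        linarith
      have hs := binomial_step N j q hjN
      have hle : ((N - j) * q : ℝ) ≤ (j + 1) * (1 - q) := by nlinarith
      refine le_of_mul_le_mul_right ?_ (show (0 : ℝ) < (j + 1) * (1 - q) by positivity)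
      change (N.choose (j + 1) : ℝ) * q ^ (j + 1) * (1 - q) ^ (N - (j + 1)) * _ ≤ _
      rw [hs]
      exact mul_le_mul_of_nonneg_left hle (hbnn j)
    · have : b (j + 1) = 0 := by simp [hb, Nat.choose_eq_zero_of_lt (Nat.lt_succ_of_le hjN)]
      rw [this]
      exact hbnn j
  have hmax : ∀ j, b j ≤ b k := by
    intro j
    rcases le_total j k with hj | hj
    · induction hj using Nat.decreasingInduction with
      | self => exact le_rfl
      | of_succ i hi ih => exact (hup i hi).trans ih
    · induction j, hj using Nat.le_induction with
      | base => exact le_rfl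
      | succ i hi ih => exact (hdown i hi).trans ih
  -- The `N + 1` weights sum to 1, so the largest is at least their average.
  have hsum : ∑ j ∈ Finset.range (N + 1), b j = 1 := by
    have := add_pow q (1 - q) N
    rw [add_sub_cancel, one_pow] at this
    rw [this]
    exact Finset.sum_congr rfl fun j _ => by simp only [hb]; ring
  calc (1 : ℝ) = ∑ j ∈ Finset.range (N + 1), b j := hsum.symm
    _ ≤ ∑ _j ∈ Finset.range (N + 1), b k := Finset.sum_le_sum fun j _ => hmax j
    _ = (N + 1 : ℝ) * b k := by simp

end Binomial

open Filter Topology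

/-! ### Asymptotics per symbol. -/

section Rates

variable {X : Type*} [Fintype X]

/-- The most likely number of changes in the Markov stream of length `N + 1`. -/
noncomputable def modeChanges (p : ℝ) (N : ℕ) : ℕ := ⌊((N : ℝ) + 1) * (1 - p)⌋₊

theorem tendsto_natCast_add_one : Tendsto (fun N : ℕ => (N : ℝ) + 1) atTop atTop :=
  tendsto_atTop_add_const_right _ _ tendsto_natCast_atTop_atTop

theorem tendsto_const_div_add_one (c : ℝ) : Tendsto (fun N : ℕ => c / ((N : ℝ) + 1)) atTop (𝓝 0) :=
  tendsto_const_nhds.div_atTop tendsto_natCast_add_one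

theorem tendsto_natCast_div_add_one : Tendsto (fun N : ℕ => (N : ℝ) / ((N : ℝ) + 1)) atTop (𝓝 1) :=
  tendsto_natCast_div_add_atTop 1

theorem tendsto_modeChanges_div {p : ℝ} (hp : p ≤ 1) :
    Tendsto (fun N => (modeChanges p N : ℝ) / ((N : ℝ) + 1)) atTop (𝓝 (1 - p)) := by
  have h := (tendsto_nat_floor_mul_div_atTop (R := ℝ) (sub_nonneg.2 hp)).comp
    tendsto_natCast_add_one
  refine h.congr fun N => ?_
  simp only [Function.comp, modeChanges, mul_comm (1 - p)]

theorem tendsto_logb_add_one_div :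
    Tendsto (fun N : ℕ => Real.logb 2 ((N : ℝ) + 1) / ((N : ℝ) + 1)) atTop (𝓝 0) := by
  have h := (Real.isLittleO_log_id_atTop.tendsto_div_nhds_zero).comp tendsto_natCast_add_one
  have h' := h.div_const (Real.log 2)
  rw [zero_div] at h'
  refine h'.congr fun N => ?_
  simp only [Function.comp, id, Real.logb]
  rw [div_right_comm]

/-- The cost is affine in the number of changes, whose density at the mode tends to `1 - p`; the
limit is the cross-entropy of a step with itself. -/
theorem tendsto_markovCost_div (hX : 2 ≤ Fintype.card X) {p : ℝ} (hp : p ∈ Set.Ioo (0 : ℝ) 1) :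
    Tendsto (fun N => markovCost X p N (modeChanges p N) / ((N : ℝ) + 1)) atTop
      (𝓝 (symbolEntropy X p)) := by
  have hm : (Fintype.card X : ℝ) - 1 ≠ 0 := by
    have : (2 : ℝ) ≤ Fintype.card X := by exact_mod_cast hX
    linarith
  have hq : 1 - p ≠ 0 := by linarith [hp.2]
  have h := ((tendsto_const_div_add_one (Real.logb 2 (Fintype.card X))).sub
    (tendsto_natCast_div_add_one.mul_const (Real.logb 2 p))).sub
    ((tendsto_modeChanges_div hp.2.le).mul_const
      (Real.logb 2 ((1 - p) / ((Fintype.card X : ℝ) - 1)) - Real.logb 2 p))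
  have e : 0 - 1 * Real.logb 2 p - (1 - p) *
      (Real.logb 2 ((1 - p) / ((Fintype.card X : ℝ) - 1)) - Real.logb 2 p) =
      symbolEntropy X p := by
    rw [symbolEntropy, H₂, Real.logb_div hq hm]
    ring
  rw [e] at h
  refine h.congr fun N => ?_
  rw [markovCost]
  ring

theorem tendsto_meanTime_div {p : ℝ} (hp : p ≤ 1) :
    Tendsto (fun N => meanTime N (modeChanges p N) / ((N : ℝ) + 1)) atTop (𝓝 (symbolTime p)) := by
  have h := (tendsto_const_nhds (x := (2 : ℝ))).sub ((tendsto_modeChanges_div hp).div_const 2)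
  have e : 2 - (1 - p) / 2 = symbolTime p := by rw [symbolTime]; ring
  rw [e] at h
  refine h.congr fun N => ?_
  rw [meanTime]
  field_simp
  ring

/-- If `a N` grows with exponential rate `h > 0`, then `n` bits fit into `a (N n)` alternatives
with `n / N n → h`. -/
theorem exists_length_of_exponential_growth {a : ℕ → ℕ} {h : ℝ} (hh : 0 < h) (ha : ∀ N, 0 < a N)
    (hlim : Tendsto (fun N : ℕ => Real.logb 2 (a N) / ((N : ℝ) + 1)) atTop (𝓝 h)) :
    ∃ N : ℕ → ℕ, Tendsto N atTop atTop ∧ (∀ n, 2 ^ n ≤ a (N n)) ∧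
      Tendsto (fun n : ℕ => (n : ℝ) / ((N n : ℝ) + 1)) atTop (𝓝 h) := by
  have hpow (n N : ℕ) : 2 ^ n ≤ a N ↔ (n : ℝ) ≤ Real.logb 2 (a N) := by
    rw [Real.le_logb_iff_rpow_le (by norm_num) (by exact_mod_cast ha N), Real.rpow_natCast]
    exact_mod_cast Iff.rfl
  have hlog : Tendsto (fun N : ℕ => Real.logb 2 (a N)) atTop atTop := by
    refine (hlim.pos_mul_atTop hh tendsto_natCast_add_one).congr fun N => ?_
    field_simp
  have hex (n : ℕ) : ∃ N, 2 ^ n ≤ a N := by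
    obtain ⟨N, hN⟩ := (hlog.eventually_ge_atTop (n : ℝ)).exists
    exact ⟨N, (hpow n N).2 hN⟩
  classical
  set L : ℕ → ℕ := fun n => Nat.find (hex n) with hL
  have hspec (n : ℕ) : 2 ^ n ≤ a (L n) := Nat.find_spec (hex n)
  have hmin (n N : ℕ) (hN : N < L n) : a N < 2 ^ n := not_le.1 (Nat.find_min (hex n) hN)
  -- If `L n < B`, then `2 ^ n ≤ a (L n)` is at most the sum of `a` below `B`, which fails once `n`
  -- reaches that sum.
  have htop : Tendsto L atTop atTop := by
    rw [tendsto_atTop]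
    intro B
    filter_upwards [eventually_ge_atTop (∑ N ∈ Finset.range B, a N)] with n hn
    by_contra hlt
    have h1 : a (L n) ≤ ∑ N ∈ Finset.range B, a N :=
      Finset.single_le_sum (f := a) (fun _ _ => Nat.zero_le _)
        (Finset.mem_range.2 (not_le.1 hlt))
    exact absurd (((hspec n).trans h1).trans hn) (not_le.2 Nat.lt_two_pow_self)
  refine ⟨L, htop, hspec, ?_⟩
  -- Minimality gives `a (L n - 1) < 2 ^ n ≤ a (L n)`; moving the index by one does not change the
  -- growth rate, so both bounds tend to `h`.
  have hlow : Tendsto (fun N : ℕ => Real.logb 2 (a (N - 1)) / ((N : ℝ) + 1)) atTop (𝓝 h) := by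
    have h1 := (hlim.comp (tendsto_sub_atTop_nat 1)).mul tendsto_natCast_div_add_one
    rw [mul_one] at h1
    refine h1.congr' ?_
    filter_upwards [eventually_ge_atTop 1] with N hN
    have hN' : (0 : ℝ) < N := by exact_mod_cast hN
    simp only [Function.comp, Nat.cast_sub hN, Nat.cast_one, sub_add_cancel]
    field_simp
  refine tendsto_of_tendsto_of_tendsto_of_le_of_le' (hlow.comp htop) (hlim.comp htop) ?_ ?_
  · filter_upwards [htop.eventually_ge_atTop 1] with n hn
    have h1 : Real.logb 2 (a (L n - 1)) ≤ n := by
      have := hmin n (L n - 1) (by omega)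
      rw [← not_le, hpow, not_le] at this
      exact this.le
    simp only [Function.comp]
    gcongr
  · refine Eventually.of_forall fun n => ?_
    have h1 := (hpow n (L n)).1 (hspec n)
    simp only [Function.comp]
    gcongr

theorem H₂_eq_binEntropy (p : ℝ) : H₂ p = Real.binEntropy p / Real.log 2 := by
  rw [H₂, Real.binEntropy]
  simp only [Real.logb, Real.log_inv]
  ring

theorem H₂_pos {p : ℝ} (hp : p ∈ Set.Ioo (0 : ℝ) 1) : 0 < H₂ p := by
  rw [H₂_eq_binEntropy]
  exact div_pos (Real.binEntropy_pos hp.1 hp.2) (Real.log_pos (by norm_num))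

theorem symbolEntropy_pos (hX : 2 ≤ Fintype.card X) {p : ℝ} (hp : p ∈ Set.Ioo (0 : ℝ) 1) :
    0 < symbolEntropy X p := by
  have : (2 : ℝ) ≤ Fintype.card X := by exact_mod_cast hX
  have hL : 0 ≤ Real.logb 2 ((Fintype.card X : ℝ) - 1) :=
    Real.logb_nonneg (by norm_num) (by linarith)
  have := mul_nonneg (sub_nonneg.2 hp.2.le) hL
  have := H₂_pos hp
  rw [symbolEntropy]
  linarith

theorem symbolTime_pos {p : ℝ} (hp : 0 ≤ p) : 0 < symbolTime p := by
  rw [symbolTime]; linarith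

theorem schemeRate_eq_div {p : ℝ} (hp : 0 ≤ p) :
    schemeRate X p = symbolEntropy X p / symbolTime p := by
  have h := symbolTime_pos hp
  rw [schemeRate, symbolEntropy, div_eq_div_iff (by linarith) h.ne', symbolTime]
  ring

end Rates

/-! ### Counting the class of typical streams and encoding into it. -/

section TypeClass

variable {X : Type*} [Fintype X] [DecidableEq X]

/-- The streams of length `N + 1` with the most likely number of changes. -/
abbrev TypicalStream (X : Type*) [DecidableEq X] (p : ℝ) (N : ℕ) : Type _ :=
  {ν : Fin (N + 1) → X // streamChanges ν = modeChanges p N}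

/-- All members have the same Markov probability, so size times this probability is the binomial
weight of the mode. -/
theorem card_typicalStream_mul (hX : 2 ≤ Fintype.card X) {p : ℝ} (hp : p ∈ Set.Ioo (0 : ℝ) 1)
    (N : ℕ) :
    (Fintype.card (TypicalStream X p N) : ℝ) * 2 ^ (-markovCost X p N (modeChanges p N)) =
      (N.choose (modeChanges p N) : ℝ) * (1 - p) ^ modeChanges p N *
        p ^ (N - modeChanges p N) := by
  rw [← sum_markovLaw_streamChanges hX, ← Finset.sum_filter, Fintype.card_subtype,
    ← nsmul_eq_mul, ← Finset.sum_const]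
  refine Finset.sum_congr rfl fun ν hν => ?_
  rw [← (Finset.mem_filter.1 hν).2, ← logb_markovLaw hX hp,
    Real.rpow_logb (by norm_num) (by norm_num) (markovLaw_pos hX hp ν)]

theorem one_le_card_typicalStream_mul (hX : 2 ≤ Fintype.card X) {p : ℝ}
    (hp : p ∈ Set.Ioo (0 : ℝ) 1) (N : ℕ) :
    1 ≤ (N + 1 : ℝ) * ((Fintype.card (TypicalStream X p N) : ℝ) *
      2 ^ (-markovCost X p N (modeChanges p N))) := by
  rw [card_typicalStream_mul hX hp]
  have := one_le_mul_binomial_mode N (q := 1 - p) ⟨by linarith [hp.2], by linarith [hp.1]⟩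
  rwa [sub_sub_cancel] at this

theorem card_typicalStream_mul_le (hX : 2 ≤ Fintype.card X) {p : ℝ}
    (hp : p ∈ Set.Ioo (0 : ℝ) 1) (N : ℕ) :
    (Fintype.card (TypicalStream X p N) : ℝ) * 2 ^ (-markovCost X p N (modeChanges p N)) ≤ 1 := by
  rw [card_typicalStream_mul hX hp, ← sum_markovLaw_streamChanges hX, ← sum_markovLaw hX p N]
  refine Finset.sum_le_sum fun ν _ => ?_
  split_ifs
  · exact le_rfl
  · exact (markovLaw_pos hX hp ν).le

theorem card_typicalStream_pos (hX : 2 ≤ Fintype.card X) {p : ℝ}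
    (hp : p ∈ Set.Ioo (0 : ℝ) 1) (N : ℕ) : 0 < Fintype.card (TypicalStream X p N) := by
  by_contra h
  have := one_le_card_typicalStream_mul hX hp N
  rw [Nat.eq_zero_of_not_pos h] at this
  norm_num at this

theorem logb_card_typicalStream_le (hX : 2 ≤ Fintype.card X) {p : ℝ}
    (hp : p ∈ Set.Ioo (0 : ℝ) 1) (N : ℕ) :
    Real.logb 2 (Fintype.card (TypicalStream X p N)) ≤ markovCost X p N (modeChanges p N) := by
  have hA : (0 : ℝ) < Fintype.card (TypicalStream X p N) := by
    exact_mod_cast card_typicalStream_pos hX hp N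
  have h := card_typicalStream_mul_le hX hp N
  rw [Real.rpow_neg (by norm_num), mul_inv_le_iff₀ (by positivity), one_mul] at h
  exact (Real.logb_le_iff_le_rpow (by norm_num) hA).2 h

/-- Restricting to one value of the number of changes costs only the `log (N + 1)` of the mode
bound, which is negligible per symbol. -/
theorem le_logb_card_typicalStream (hX : 2 ≤ Fintype.card X) {p : ℝ}
    (hp : p ∈ Set.Ioo (0 : ℝ) 1) (N : ℕ) :
    markovCost X p N (modeChanges p N) - Real.logb 2 (N + 1) ≤
      Real.logb 2 (Fintype.card (TypicalStream X p N)) := by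
  have hA : (0 : ℝ) < Fintype.card (TypicalStream X p N) := by
    exact_mod_cast card_typicalStream_pos hX hp N
  have h := Real.logb_le_logb_of_le (b := 2) (by norm_num) (by norm_num)
    (one_le_card_typicalStream_mul hX hp N)
  rw [Real.logb_one, Real.logb_mul (by positivity) (by positivity),
    Real.logb_mul (by positivity) (by positivity), Real.logb_rpow (by norm_num) (by norm_num)] at h
  linarith

theorem tendsto_logb_card_typicalStream_div (hX : 2 ≤ Fintype.card X) {p : ℝ}
    (hp : p ∈ Set.Ioo (0 : ℝ) 1) :
    Tendsto (fun N : ℕ => Real.logb 2 (Fintype.card (TypicalStream X p N)) / ((N : ℝ) + 1)) atTop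
      (𝓝 (symbolEntropy X p)) := by
  have h1 := tendsto_markovCost_div hX hp
  have h0 := h1.sub tendsto_logb_add_one_div
  rw [sub_zero] at h0
  refine tendsto_of_tendsto_of_tendsto_of_le_of_le h0 h1 (fun N => ?_) fun N => ?_
  · simp only [← sub_div]
    have := le_logb_card_typicalStream hX hp N
    gcongr
  · have := logb_card_typicalStream_le hX hp N
    simp only
    gcongr

/-- The relative entropy of a uniformly chosen typical stream with respect to the Markov law. -/
theorem relEntropy_streamLaw (hX : 2 ≤ Fintype.card X) {p : ℝ} (hp : p ∈ Set.Ioo (0 : ℝ) 1)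
    {n N d : ℕ} {φ : (Fin n → Bool) → Fin (N + 1) → X} (hφ : Function.Injective φ)
    (hd : ∀ m, streamChanges (φ m) = d) :
    relEntropy (streamLaw φ) (markovLaw p N) = markovCost X p N d - n := by
  have hcard : (Fintype.card (Fin n → Bool) : ℝ) = 2 ^ n := by simp
  have hin (m : Fin n → Bool) : streamLaw φ (φ m) = 1 / 2 ^ n := by
    have : Fintype.card {m' // φ m' = φ m} = 1 :=
      Fintype.card_eq_one_iff.2 ⟨⟨m, rfl⟩, fun y => Subtype.ext (hφ y.2)⟩
    rw [streamLaw, hcard, this, Nat.cast_one]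
  have hout (ν : Fin (N + 1) → X) (hν : ν ∉ Finset.univ.image φ) : streamLaw φ ν = 0 := by
    have : IsEmpty {m // φ m = ν} :=
      ⟨fun m => hν (Finset.mem_image.2 ⟨m.1, Finset.mem_univ _, m.2⟩)⟩
    simp [streamLaw]
  rw [relEntropy, ← Finset.sum_subset (Finset.subset_univ (Finset.univ.image φ))
    fun ν _ hν => by rw [hout ν hν, zero_mul], Finset.sum_image fun _ _ _ _ h => hφ h]
  -- On the image both laws are constant, `2 ^ (-n)` and `2 ^ (-markovCost)`, so the log-ratio is
  -- constant as well.
  have e (m : Fin n → Bool) : streamLaw φ (φ m) *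
      Real.logb 2 (streamLaw φ (φ m) / markovLaw p N (φ m)) =
      1 / 2 ^ n * (markovCost X p N d - n) := by
    rw [hin, Real.logb_div (by positivity) (markovLaw_pos hX hp _).ne', logb_markovLaw hX hp, hd,
      one_div, Real.logb_inv, Real.logb_pow, Real.logb_self_eq_one (by norm_num)]
    ring
  rw [Finset.sum_congr rfl fun m _ => e m, Finset.sum_const, Finset.card_univ, nsmul_eq_mul,
    hcard]
  field_simp

/-- Since every codeword has the same number of changes, the expected time is the same for every
message and averaging is trivial. -/
theorem exists_typical_codes (hX : 2 ≤ Fintype.card X) {p : ℝ} (hp : p ∈ Set.Ioo (0 : ℝ) 1) :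
    ∃ (N : ℕ → ℕ) (φ : ∀ n : ℕ, (Fin n → Bool) → Fin (N n + 1) → X),
      (∀ n, Function.Injective (φ n)) ∧
      (∀ n, (schemeCode (φ n)).ZeroErrorWithin (2 * (N n + 1))) ∧
      Tendsto (fun n => relEntropy (streamLaw (φ n)) (markovLaw p (N n)) / ((N n : ℝ) + 1))
        atTop (𝓝 0) ∧
      Tendsto (fun n : ℕ => (n : ℝ) / ((N n : ℝ) + 1)) atTop (𝓝 (symbolEntropy X p)) ∧
      ∀ s₀ : X,
        Tendsto (fun n => ((∑ m, (schemeCode (φ n)).expectedTime s₀ m) / (2 : ℝ) ^ n) /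
          ((N n : ℝ) + 1)) atTop (𝓝 (symbolTime p)) ∧
        Tendsto (fun n : ℕ =>
          (n : ℝ) / ((∑ m, (schemeCode (φ n)).expectedTime s₀ m) / (2 : ℝ) ^ n))
          atTop (𝓝 (schemeRate X p)) := by
  obtain ⟨N, hN, hcard, hlim⟩ := exists_length_of_exponential_growth (symbolEntropy_pos hX hp)
    (card_typicalStream_pos hX hp) (tendsto_logb_card_typicalStream_div hX hp)
  have hemb (n : ℕ) : Nonempty ((Fin n → Bool) ↪ TypicalStream X p (N n)) :=
    Function.Embedding.nonempty_of_card_le (by simpa using hcard n)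
  let φ : ∀ n : ℕ, (Fin n → Bool) → Fin (N n + 1) → X := fun n m => ((hemb n).some m).1
  have hφ (n : ℕ) : Function.Injective (φ n) := fun m m' h =>
    (hemb n).some.injective (Subtype.ext h)
  have hd (n : ℕ) (m : Fin n → Bool) : streamChanges (φ n m) = modeChanges p (N n) :=
    ((hemb n).some m).2
  have htime (s₀ : X) (n : ℕ) : (∑ m, (schemeCode (φ n)).expectedTime s₀ m) / (2 : ℝ) ^ n =
      meanTime (N n) (modeChanges p (N n)) := by
    rw [Finset.sum_congr rfl fun m _ => (schemeCode_expectedTime (hφ n) s₀ m).trans (by rw [hd])]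
    simp
  have hT := (tendsto_meanTime_div hp.2.le).comp hN
  refine ⟨N, φ, hφ, fun n => schemeCode_zeroErrorWithin (hφ n), ?_, hlim, fun s₀ => ⟨?_, ?_⟩⟩
  · have h := ((tendsto_markovCost_div hX hp).comp hN).sub hlim
    rw [sub_self] at h
    refine h.congr fun n => ?_
    rw [relEntropy_streamLaw hX hp (hφ n) (hd n), sub_div]
    rfl
  · simp only [htime]
    exact hT
  · simp only [htime]
    rw [schemeRate_eq_div hp.1.le]
    refine (hlim.div hT (symbolTime_pos hp.1.le).ne').congr fun n => ?_
    simp only [Function.comp, Pi.div_apply]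
    rw [div_div_div_cancel_right₀ (by positivity)]

end TypeClass

/-! ### From variable length to fixed block length. -/

section BlockCodes

/-- The block decoder scans the prefixes of the received block and returns the first announcement;
later outputs are ignored, and a block without announcement is decoded arbitrarily. -/
theorem VarCode.exists_blockDecoder {M X : Type*} [Nonempty M] (C : VarCode M X) :
    ∃ dec : List X → M, ∀ (s₀ : X) (m : M) (ω : ℕ → Bool) (t T : ℕ),
      C.StopsWith s₀ m ω t m → t ≤ T → dec (outputs (C.encode m) s₀ ω T) = m := by
  classical
  let P : List X → M → Prop := fun ys m => ∃ k, C.decide (ys.take k) = some m ∧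
    ∀ j < k, C.decide (ys.take j) = none
  refine ⟨fun ys => if h : ∃ m, P ys m then h.choose else Classical.arbitrary M, ?_⟩
  intro s₀ m ω t T ht htT
  have htake {j : ℕ} (hj : j ≤ t) : (outputs (C.encode m) s₀ ω T).take j =
      outputs (C.encode m) s₀ ω j := outputs_take _ _ _ (hj.trans htT)
  have hex : ∃ m', P (outputs (C.encode m) s₀ ω T) m' :=
    ⟨m, t, by rw [htake le_rfl]; exact ht.1, fun j hj => by rw [htake hj.le]; exact ht.2 j hj⟩
  simp only [dif_pos hex]
  obtain ⟨k, hk, hk'⟩ := hex.choose_spec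
  rcases lt_trichotomy k t with h | h | h
  · rw [htake h.le, ht.2 k h] at hk
    cases hk
  · rw [h, htake le_rfl, ht.1] at hk
    exact (Option.some_injective _ hk).symm
  · have := hk' t h
    rw [htake le_rfl, ht.1] at this
    cases this

variable {X : Type*} [Fintype X] [DecidableEq X]

/-- Block codes obtained by running the scheme on typical streams for a fixed time. -/
theorem exists_blockCode (hX : 2 ≤ Fintype.card X) {p : ℝ} (hp : p ∈ Set.Ioo (0 : ℝ) 1)
    {N T : ℕ} (hT : meanTime N (modeChanges p N) < T) :
    ∃ (enc : Fin (Fintype.card (TypicalStream X p N)) → List X → X)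
      (dec : List X → Fin (Fintype.card (TypicalStream X p N))), ∀ s₀ m,
        (coinLaw {ω | dec (outputs (enc m) s₀ ω T) ≠ m}).toReal ≤
          N / (4 * (T - meanTime N (modeChanges p N)) ^ 2) := by
  have : Nonempty (Fin (Fintype.card (TypicalStream X p N))) :=
    ⟨⟨0, card_typicalStream_pos hX hp N⟩⟩
  let e := (Fintype.equivFin (TypicalStream X p N)).symm
  let φ : Fin (Fintype.card (TypicalStream X p N)) → Fin (N + 1) → X := fun m => (e m).1
  have hφ : Function.Injective φ := fun m m' h => e.injective (Subtype.ext h)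
  obtain ⟨dec, hdec⟩ := (schemeCode φ).exists_blockDecoder
  refine ⟨(schemeCode φ).encode, dec, fun s₀ m => ?_⟩
  have hd : streamChanges (φ m) = modeChanges p N := (e m).2
  have h := coinLaw_lt_streamTime_le (φ m) (T := T) (by rw [hd]; exact hT)
  rw [hd] at h
  refine (ENNReal.toReal_mono (measure_ne_top _ _) (measure_mono fun ω hω => ?_)).trans h
  by_contra hle
  exact hω (hdec s₀ m ω _ T (schemeCode_stopsWith hφ s₀ m ω) (not_lt.1 hle))

theorem isAchievable_schemeRate (hX : 2 ≤ Fintype.card X) {p : ℝ} (hp : p ∈ Set.Ioo (0 : ℝ) 1) :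
    IsAchievable X (schemeRate X p) := by
  intro ε hε
  have hh := symbolEntropy_pos hX hp
  have hl := symbolTime_pos hp.1.le
  -- `c` is the number of symbols per channel use. Below `1 / ℓ` it leaves a gap between mean time
  -- and `T` linear in `T`; above `(R - ε) / h` it keeps the rate. Such `c` exists because `R = h /
  -- ℓ`, and `c > 0` makes `N` tend to infinity.
  obtain ⟨c, hc, hc1⟩ : ∃ c, max 0 ((schemeRate X p - ε) / symbolEntropy X p) < c ∧
      c < 1 / symbolTime p := by
    refine exists_between (max_lt (by positivity) ?_)
    rw [div_lt_iff₀ hh, schemeRate_eq_div hp.1.le, one_div_mul_eq_div]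
    linarith
  obtain ⟨hc0, hcR⟩ := max_lt_iff.1 hc
  rw [div_lt_iff₀ hh] at hcR
  rw [lt_div_iff₀ hl] at hc1
  set N : ℕ → ℕ := fun T => ⌊c * T⌋₊ with hNdef
  have hNT : Tendsto (fun T : ℕ => (N T : ℝ) / T) atTop (𝓝 c) :=
    (tendsto_nat_floor_mul_div_atTop hc0.le).comp tendsto_natCast_atTop_atTop
  have hN1T : Tendsto (fun T : ℕ => ((N T : ℝ) + 1) / T) atTop (𝓝 c) := by
    have := hNT.add (tendsto_const_div_atTop_nhds_zero_nat 1)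
    rw [add_zero] at this
    exact this.congr fun T => (add_div _ _ _).symm
  have hNtop : Tendsto N atTop atTop :=
    tendsto_nat_floor_atTop.comp (tendsto_natCast_atTop_atTop.const_mul_atTop hc0)
  have hbits : Tendsto (fun T : ℕ =>
      Real.logb 2 (Fintype.card (TypicalStream X p (N T))) / T) atTop
      (𝓝 (symbolEntropy X p * c)) := by
    refine (((tendsto_logb_card_typicalStream_div hX hp).comp hNtop).mul hN1T).congr fun T => ?_
    simp only [Function.comp]
    rw [div_mul_div_cancel₀ (by positivity)]
  have hmean : Tendsto (fun T : ℕ => meanTime (N T) (modeChanges p (N T)) / T) atTop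
      (𝓝 (symbolTime p * c)) := by
    refine (((tendsto_meanTime_div hp.2.le).comp hNtop).mul hN1T).congr fun T => ?_
    simp only [Function.comp]
    rw [div_mul_div_cancel₀ (by positivity)]
  -- The numerator is linear in `T` and the squared gap quadratic, so the Chebyshev bound is of
  -- order `1 / T`.
  have herr : Tendsto (fun T : ℕ =>
      (N T : ℝ) / (4 * (T - meanTime (N T) (modeChanges p (N T))) ^ 2)) atTop (𝓝 0) := by
    have hden : 4 * (1 - symbolTime p * c) ^ 2 ≠ 0 := by
      have : 0 < 1 - symbolTime p * c := by linarith
      positivity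
    have h := ((hNT.mul (tendsto_const_div_atTop_nhds_zero_nat 1)).div
      (((tendsto_const_nhds.sub hmean).pow 2).const_mul 4) hden)
    rw [mul_zero, zero_div] at h
    refine h.congr' ?_
    filter_upwards [eventually_gt_atTop 0] with T hT
    have hT' : (T : ℝ) ≠ 0 := by exact_mod_cast hT.ne'
    simp only [Pi.div_apply]
    have e1 : (1 - meanTime (N T) (modeChanges p (N T)) / T : ℝ) =
        (T - meanTime (N T) (modeChanges p (N T))) / T := by field_simp
    rw [e1, div_pow, div_mul_div_comm, mul_one, ← sq, mul_div_assoc',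
      div_div_div_cancel_right₀ (by positivity)]
  filter_upwards [eventually_gt_atTop 0, hbits.eventually_const_lt
    (show schemeRate X p - ε < _ by linarith), hmean.eventually_lt_const
    (show _ < (1 : ℝ) by linarith), herr.eventually_lt_const hε] with T hT0 hT1 hT2 hT3
  have hT0' : (0 : ℝ) < T := by exact_mod_cast hT0
  rw [lt_div_iff₀ hT0'] at hT1
  rw [div_lt_one hT0'] at hT2
  obtain ⟨enc, dec, h⟩ := exists_blockCode hX hp hT2
  refine ⟨_, enc, dec, ?_, fun s₀ m => (h s₀ m).trans hT3.le⟩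
  rw [← Real.le_logb_iff_rpow_le (by norm_num)
    (by exact_mod_cast card_typicalStream_pos hX hp (N T)), mul_comm]
  exact hT1.le

end BlockCodes

/-! ### Existence and location of the maximum. -/

section Maximum

variable {X : Type*} [Fintype X]

theorem H₂_zero : H₂ 0 = 0 := by simp [H₂]

theorem H₂_one : H₂ 1 = 0 := by simp [H₂]

theorem continuousOn_schemeRate : ContinuousOn (schemeRate X) (Set.Icc 0 1) := by
  have hH : Continuous H₂ := by
    have : H₂ = fun p => Real.binEntropy p / Real.log 2 := funext H₂_eq_binEntropy
    rw [this]
    exact Real.binEntropy_continuous.div_const _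
  unfold schemeRate
  refine ContinuousOn.div (by fun_prop) (by fun_prop) fun p hp => ?_
  have := hp.1
  linarith

/-- Cross-multiplied, the claim is `3 H₂(p) > 4 p log (m - 1)`. At `p = 1 / m²` the summand `p log
(1 / p) = 2 p log m` of `H₂` suffices; at `1 / m` this bound would be too small. -/
theorem schemeRate_zero_lt (hX : 2 ≤ Fintype.card X) :
    schemeRate X 0 < schemeRate X (1 / (Fintype.card X : ℝ) ^ 2) := by
  have hm : (2 : ℝ) ≤ Fintype.card X := by exact_mod_cast hX
  set m : ℝ := (Fintype.card X : ℝ) with hmdef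
  set p : ℝ := 1 / m ^ 2 with hpdef
  have hp0 : 0 < p := by positivity
  have hp1 : p < 1 := by rw [hpdef, div_lt_one (by positivity)]; nlinarith
  have hlogm : 0 < Real.logb 2 m := Real.logb_pos (by norm_num) (by linarith)
  have hL : Real.logb 2 (m - 1) ≤ Real.logb 2 m :=
    Real.logb_le_logb_of_le (by norm_num) (by linarith) (by linarith)
  have hH : 2 * p * Real.logb 2 m ≤ H₂ p := by
    have h1 : Real.logb 2 p = -(2 * Real.logb 2 m) := by
      rw [hpdef, one_div, Real.logb_inv, Real.logb_pow]; norm_num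
    have h2 : Real.logb 2 (1 - p) ≤ 0 :=
      Real.logb_nonpos (by norm_num) (by linarith) (by linarith)
    rw [H₂, h1]
    nlinarith
  rw [schemeRate, schemeRate, H₂_zero, ← hmdef, div_lt_div_iff₀ (by norm_num) (by linarith)]
  have h3 : p * Real.logb 2 (m - 1) ≤ p * Real.logb 2 m := by gcongr
  have h4 : 0 < p * Real.logb 2 m := by positivity
  linarith

theorem exists_isMaxOn_schemeRate (hX : 2 ≤ Fintype.card X) :
    ∃ p ∈ Set.Ioo (0 : ℝ) 1, IsGreatest (schemeRate X '' Set.Icc 0 1) (schemeRate X p) := by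
  obtain ⟨p, hp, hmax⟩ := isCompact_Icc.exists_isMaxOn (Set.nonempty_Icc.2 zero_le_one)
    (continuousOn_schemeRate (X := X))
  have hm : (2 : ℝ) ≤ Fintype.card X := by exact_mod_cast hX
  refine ⟨p, ⟨lt_of_le_of_ne hp.1 ?_, lt_of_le_of_ne hp.2 ?_⟩, Set.mem_image_of_mem _ hp, ?_⟩
  · rintro rfl
    refine absurd (hmax (a := 1 / (Fintype.card X : ℝ) ^ 2) ⟨by positivity, ?_⟩)
      (not_le.2 (schemeRate_zero_lt hX))
    rw [div_le_one (by positivity)]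
    nlinarith
  -- At `p = 1` the stream is constant and the rate is 0, while it is positive at 1/2.
  · rintro rfl
    have hhalf : (1 / 2 : ℝ) ∈ Set.Ioo (0 : ℝ) 1 := by constructor <;> norm_num
    have h0 : schemeRate X 1 = 0 := by simp [schemeRate, H₂_one]
    have h1 : 0 < schemeRate X (1 / 2) := by
      rw [schemeRate_eq_div hhalf.1.le]
      exact div_pos (symbolEntropy_pos hX hhalf) (symbolTime_pos hhalf.1.le)
    have h2 : schemeRate X (1 / 2) ≤ schemeRate X 1 := hmax ⟨hhalf.1.le, hhalf.2.le⟩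
    linarith
  · rintro _ ⟨q, hq, rfl⟩
    exact hmax hq

theorem schemeRate_of_card_eq_three (hX : Fintype.card X = 3) :
    schemeRate X = fun p : ℝ => 2 * (H₂ p + 1 - p) / (p + 3) := by
  funext p
  have : Real.logb 2 ((3 : ℕ) - 1 : ℝ) = 1 := by
    norm_num
  rw [schemeRate, hX, this, mul_one, add_sub_assoc]

end Maximum

end Ising

theorem theorem3 {X : Type*} [Fintype X] [DecidableEq X] (hX : 2 ≤ Fintype.card X) :
    -- every stream of symbols is transmitted without error
    (∀ N : ℕ, (Ising.schemeCode (fun ν : Fin (N + 1) → X => ν)).ZeroErrorWithin (2 * (N + 1))) ∧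
    -- entropy and expected transmission length of the Markov symbol stream
    (∀ p ∈ Set.Icc (0 : ℝ) 1, ∀ N : ℕ,
      (∑ ν : Fin (N + 1) → X, Ising.markovLaw p N ν = 1) ∧
      Ising.entropy (Ising.markovLaw (X := X) p N) =
        Real.logb 2 (Fintype.card X) + N * Ising.symbolEntropy X p ∧
      ∀ s₀ : X,
        ∑ ν : Fin (N + 1) → X, Ising.markovLaw p N ν *
            (Ising.schemeCode (fun ν : Fin (N + 1) → X => ν)).expectedTime s₀ ν =
          2 + N * Ising.symbolTime p) ∧
    -- `n` uniform bits are mapped to a stream with the Markov statistics; the resulting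
    -- zero-error code has rate tending to entropy rate / expected transmission length
    (∀ p ∈ Set.Ioo (0 : ℝ) 1,
      Ising.schemeRate X p = Ising.symbolEntropy X p / Ising.symbolTime p ∧
      ∃ (N : ℕ → ℕ) (φ : ∀ n : ℕ, (Fin n → Bool) → Fin (N n + 1) → X),
        (∀ n, Function.Injective (φ n)) ∧
        (∀ n, (Ising.schemeCode (φ n)).ZeroErrorWithin (2 * (N n + 1))) ∧
        Filter.Tendsto
          (fun n => Ising.relEntropy (Ising.streamLaw (φ n)) (Ising.markovLaw p (N n)) /
            ((N n : ℝ) + 1))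
          Filter.atTop (nhds 0) ∧
        Filter.Tendsto (fun n : ℕ => (n : ℝ) / ((N n : ℝ) + 1))
          Filter.atTop (nhds (Ising.symbolEntropy X p)) ∧
        ∀ s₀ : X,
          Filter.Tendsto
            (fun n => ((∑ m, (Ising.schemeCode (φ n)).expectedTime s₀ m) / (2 : ℝ) ^ n) /
              ((N n : ℝ) + 1))
            Filter.atTop (nhds (Ising.symbolTime p)) ∧
          Filter.Tendsto
            (fun n : ℕ =>
              (n : ℝ) / ((∑ m, (Ising.schemeCode (φ n)).expectedTime s₀ m) / (2 : ℝ) ^ n))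
            Filter.atTop (nhds (Ising.schemeRate X p))) ∧
    -- the best parameter, the maximal rate, and its value for a ternary alphabet
    ∃ R : ℝ,
      IsGreatest (Ising.schemeRate X '' Set.Icc 0 1) R ∧
      (∃ p ∈ Set.Ioo (0 : ℝ) 1, Ising.schemeRate X p = R) ∧
      Ising.IsAchievable X R ∧
      (Fintype.card X = 3 →
        IsGreatest ((fun p : ℝ => 2 * (Ising.H₂ p + 1 - p) / (p + 3)) '' Set.Icc 0 1) R) := by

  refine ⟨fun N => Ising.schemeCode_zeroErrorWithin fun _ _ h => h,
    fun p _ N => ⟨Ising.sum_markovLaw hX p N, Ising.entropy_markovLaw hX p N,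
      Ising.sum_markovLaw_mul_expectedTime hX p N⟩,
    fun p hp => ⟨Ising.schemeRate_eq_div hp.1.le, Ising.exists_typical_codes hX hp⟩, ?_⟩
  obtain ⟨p, hp, hmax⟩ := Ising.exists_isMaxOn_schemeRate hX
  refine ⟨_, hmax, ⟨p, hp, rfl⟩, Ising.isAchievable_schemeRate hX hp, fun h3 => ?_⟩
  rwa [← Ising.schemeRate_of_card_eq_three h3]
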